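/- For $\rho,\delta\in\{0,1\}$ and $d\in\mathbb R$ let $S^d_{\rho,\delta}(\mathbb R^n\times\mathbb R^n)$ be the set of $b\in C^\infty(\mathbb R^n\times\mathbb R^n;\mathbb C)$ with $|D_\xi^\alpha D_x^\beta b(x,\xi)|\le C_{\alpha\beta}(1+|\xi|)^{d-\rho|\alpha|+\delta|\beta|}$ for all multi-indices $\alpha,\beta$ and all $x,\xi$, and let $S^\infty_{1,1}=\bigcup_{d}S^d_{1,1}$. Let $\hat u(\xi)=\mathcal Fu(\xi)=\int e^{-ix\cdot\xi}u(x)\,dx$, extended as usual to $\mathcal S'(\mathbb R^n)$, and let $\hat b(\xi,\eta)=\mathcal F_{x\to\xi}b(x,\eta)$, a tempered distribution on $\mathbb R^n\times\mathbb R^n$. For $u\in\mathcal S(\mathbb R^n)$ set $b(x,D)u(x)=(2\pi)^{-n}\int e^{ix\cdot\xi}b(x,\xi)\hat u(\xi)\,d\xi$. Supports are supports of distributions. For $v\in\mathcal S'(\mathbb R^n)$ put $$\Sigma(b,v)=\{\,\xi+\eta \mid (\xi,\eta)\in\operatorname{supp}\hat b,\ \eta\in\operatorname{supp}\hat v\,\}.$$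 **Proposition (the support rule).** (1) Let $b\in S^d_{1,0}(\mathbb R^n\times\mathbb R^n)$. Then $b(x,D)$ has a unique continuous linear extension $b(x,D)\colon\mathcal S'(\mathbb R^n)\to\mathcal S'(\mathbb R^n)$ (for the topology of pointwise convergence on $\mathcal S'$), and for every $v\in\mathcal S'(\mathbb R^n)$ such that $\operatorname{supp}\hat v$ is compact, $$\operatorname{supp}\mathcal F(b(x,D)v)\subset\Sigma(b,v).$$ (2) Let $b\in S^\infty_{1,1}(\mathbb R^n\times\mathbb R^n)$ and let $v\in\mathcal S'(\mathbb R^n)$ be such that $\operatorname{supp}\hat v$ is compact. Define $b(x,D)v:=(b\chi)(x,D)v$, where $\chi=\chi(\xi)\in C_c^\infty(\mathbb R^n)$ equals $1$ in a neighbourhood of $\operatorname{supp}\hat v$ and $(b\chi)(x,D)\colon\mathcal S'\to\mathcal S'$ is the extension in (1) (note that $b\chi\in S^m_{1,0}$ for all $m$). This is well defined, independent of the choice of $\chi$; it is given by the integral formula if $v\in\mathcal S(\mathbb R^n)$, and it equals $Tv$ whenever $T\colon\mathcal S'\to\mathcal S'$ is a continuous linear extension of $b(x,D)$, in particular if $b\in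 S^d_{1,0}$ for some $d$. Moreover $$\operatorname{supp}\mathcal F(b(x,D)v)\subset\Sigma(b,v).$$ -/

import Mathlib

open MeasureTheory
open scoped SchwartzMap ContDiff Topology

namespace SupportRule

/-- The symbol class `S^d_{ρ,δ}(ℝⁿ × ℝⁿ)`: `b` is smooth and, for all orders `k` (of differentiation
in `x`) and `l` (in `ξ`), `|∂_x^k ∂_ξ^l b(x, ξ)| ≤ C_{kl} (1 + |ξ|)^{d - ρ l + δ k}`. The norm of the
iterated Fréchet derivative controls, and is controlled by, all the mixed partial derivatives
`D_ξ^α D_x^β b` with `|α| = l`, `|β| = k`. -/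
def IsSymbol {n : ℕ} (d ρ δ : ℝ)
    (b : EuclideanSpace ℝ (Fin n) → EuclideanSpace ℝ (Fin n) → ℂ) : Prop :=
  ContDiff ℝ ∞ (fun p : EuclideanSpace ℝ (Fin n) × EuclideanSpace ℝ (Fin n) => b p.1 p.2) ∧
  ∀ k l : ℕ, ∃ C : ℝ, ∀ x ξ : EuclideanSpace ℝ (Fin n),
    ‖iteratedFDeriv ℝ k (fun y => iteratedFDeriv ℝ l (b y) ξ) x‖
      ≤ C * (1 + ‖ξ‖) ^ (d - ρ * l + δ * k)

/-- The dilation `ξ ↦ (2π)⁻¹ ξ` of `ℝⁿ`. -/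
noncomputable def dilation (n : ℕ) :
    EuclideanSpace ℝ (Fin n) ≃L[ℝ] EuclideanSpace ℝ (Fin n) :=
  ContinuousLinearEquiv.smulLeft (Units.mk0 ((2 * Real.pi)⁻¹ : ℝ) (by positivity))

/-- The Fourier transform `û(ξ) = ∫ e^{-i x·ξ} u(x) dx` on the Schwartz space. Mathlib's transform
has the kernel `e^{-2π i x·ξ}`, hence the dilation; see `fourierS_apply`. -/
noncomputable def fourierS (n : ℕ) :
    𝓢(EuclideanSpace ℝ (Fin n), ℂ) →L[ℂ] 𝓢(EuclideanSpace ℝ (Fin n), ℂ) :=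
  (SchwartzMap.compCLMOfContinuousLinearEquiv ℂ (dilation n)).comp
    (FourierTransform.fourierCLM ℂ 𝓢(EuclideanSpace ℝ (Fin n), ℂ))

theorem fourierS_apply {n : ℕ} (u : 𝓢(EuclideanSpace ℝ (Fin n), ℂ))
    (ξ : EuclideanSpace ℝ (Fin n)) :
    fourierS n u ξ = ∫ x, Complex.exp (-Complex.I * (inner ℝ x ξ : ℝ)) * u x := by
  have h : fourierS n u ξ
      = FourierTransform.fourier (u : EuclideanSpace ℝ (Fin n) → ℂ) ((2 * Real.pi)⁻¹ • ξ) := by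
    rw [← SchwartzMap.fourier_coe]
    rfl
  rw [h, Real.fourier_eq']
  congr 1
  ext x
  rw [smul_eq_mul, inner_smul_right]
  congr 2
  have : (Real.pi : ℂ) ≠ 0 := by exact_mod_cast Real.pi_ne_zero
  push_cast
  field_simp

/-- The Fourier transform on tempered distributions: `⟨v̂, φ⟩ = ⟨v, φ̂⟩`. -/
noncomputable def fourierD (n : ℕ) :
    𝓢'(EuclideanSpace ℝ (Fin n), ℂ) →L[ℂ] 𝓢'(EuclideanSpace ℝ (Fin n), ℂ) :=
  PointwiseConvergenceCLM.precomp ℂ (fourierS n)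

/-- The function `b(x, D)u(x) = (2π)⁻ⁿ ∫ e^{i x·ξ} b(x, ξ) û(ξ) dξ` for a Schwartz function `u`. -/
noncomputable def opS {n : ℕ}
    (b : EuclideanSpace ℝ (Fin n) → EuclideanSpace ℝ (Fin n) → ℂ)
    (u : 𝓢(EuclideanSpace ℝ (Fin n), ℂ)) (x : EuclideanSpace ℝ (Fin n)) : ℂ :=
  ((2 * Real.pi : ℂ) ^ n)⁻¹ *
    ∫ ξ, Complex.exp (Complex.I * (inner ℝ x ξ : ℝ)) * b x ξ * fourierS n u ξ

/-- The tempered distribution `f` is the function `g`. -/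
def IsRepresentedBy {n : ℕ} (f : 𝓢'(EuclideanSpace ℝ (Fin n), ℂ))
    (g : EuclideanSpace ℝ (Fin n) → ℂ) : Prop :=
  ∀ φ : 𝓢(EuclideanSpace ℝ (Fin n), ℂ),
    Integrable (fun x => φ x * g x) ∧ f φ = ∫ x, φ x * g x

/-- The continuous linear map `T : 𝓢' → 𝓢'` extends `b(x, D)` from the Schwartz functions. -/
def IsExtension {n : ℕ} (b : EuclideanSpace ℝ (Fin n) → EuclideanSpace ℝ (Fin n) → ℂ)
    (T : 𝓢'(EuclideanSpace ℝ (Fin n), ℂ) →L[ℂ] 𝓢'(EuclideanSpace ℝ (Fin n), ℂ)) : Prop :=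
  ∀ u : 𝓢(EuclideanSpace ℝ (Fin n), ℂ),
    IsRepresentedBy (T (u : 𝓢'(EuclideanSpace ℝ (Fin n), ℂ))) (opS b u)

/-- `f = b(x, D)v` for a `v` with compactly supported Fourier transform: `f = (b χ)(x, D)v`, where
`χ = χ(ξ)` is a smooth compactly supported function that is `1` in a neighbourhood of the support
of `v̂`, and where `(b χ)(x, D)` is the continuous map `𝓢' → 𝓢'`. (If `b` is in `S^d_{1,1}` then
`b χ` is in `S^m_{1,0}` for every `m`.) -/
def IsOpValue {n : ℕ} (b : EuclideanSpace ℝ (Fin n) → EuclideanSpace ℝ (Fin n) → ℂ)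
    (v f : 𝓢'(EuclideanSpace ℝ (Fin n), ℂ)) : Prop :=
  ∃ (χ : EuclideanSpace ℝ (Fin n) → ℂ)
    (T : 𝓢'(EuclideanSpace ℝ (Fin n), ℂ) →L[ℂ] 𝓢'(EuclideanSpace ℝ (Fin n), ℂ)),
    ContDiff ℝ ∞ χ ∧ HasCompactSupport χ ∧
    (∀ᶠ ξ in 𝓝ˢ (Distribution.dsupport (fourierD n v)), χ ξ = 1) ∧
    IsExtension (fun x ξ => b x ξ * χ ξ) T ∧ f = T v

/-- The partial Fourier transform `b̂(ξ, η) = 𝓕_{x → ξ} b(x, η)` of `b`, as a distribution on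
`ℝⁿ × ℝⁿ`: `⟨b̂, Φ⟩ = ∫∫ b(x, η) (∫ e^{-i x·ξ} Φ(ξ, η) dξ) dx dη`. -/
noncomputable def partialFourier {n : ℕ}
    (b : EuclideanSpace ℝ (Fin n) → EuclideanSpace ℝ (Fin n) → ℂ)
    (Φ : 𝓢(EuclideanSpace ℝ (Fin n) × EuclideanSpace ℝ (Fin n), ℂ)) : ℂ :=
  ∫ p : EuclideanSpace ℝ (Fin n) × EuclideanSpace ℝ (Fin n),
    b p.1 p.2 * ∫ ξ, Complex.exp (-Complex.I * (inner ℝ p.1 ξ : ℝ)) * Φ (ξ, p.2)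

/-- The set `{ξ + η | (ξ, η) ∈ supp b̂, η ∈ supp v̂}`. -/
def sumSet {n : ℕ} (b : EuclideanSpace ℝ (Fin n) → EuclideanSpace ℝ (Fin n) → ℂ)
    (v : 𝓢'(EuclideanSpace ℝ (Fin n), ℂ)) : Set (EuclideanSpace ℝ (Fin n)) :=
  {ζ | ∃ ξ η : EuclideanSpace ℝ (Fin n),
    (ξ, η) ∈ Distribution.dsupport (partialFourier b) ∧
    η ∈ Distribution.dsupport (fourierD n v) ∧ ζ = ξ + η}

end SupportRule

/-!
The transpose of `b(x, D)` with respect to the pairing of `𝓢'` with `𝓢` is explicit: by Fubini's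
theorem
`⟨b(x, D)u, φ⟩ = (2π)⁻ⁿ ⟨û, A φ⟩`, where `A φ (ξ) = ∫ e^{i x·ξ} b(x, ξ) φ(x) dx`,
so that `b(x, D)` extends to `𝓢'` as soon as `A` (`oscIntegral`) is continuous on `𝓢`. A
derivative of `A φ` in `ξ` falls on `b` or produces a factor `x`, and a factor `ξ` becomes, by
integration by parts, a derivative in `x` of `b` or of `φ`. Hence `A` is continuous (`oscCLM`)
if all derivatives of `b` are bounded by one and the same power of `1 + |ξ|`. This is the class
`IsAmplitude`. It contains `S^d_{1,0}`, and also `b χ` for `b` in `S^d_{1,1}` and a cut-off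
`χ = χ(ξ)`; that bounds on the mixed derivatives of a symbol give bounds on its total derivatives is
`norm_iteratedFDeriv_le_of_mixed`.

The extension is unique (`IsExtension.unique`) since a continuous functional on `𝓢'`, for
pointwise convergence, is the evaluation at some `ψ` in `𝓢`, and `ψ = 0` if it vanishes on the
Schwartz functions.

For the rest, the basic fact is that `⟨v̂, f⟩` depends only on `f` near `supp v̂`
(`apply_eq_of_eventually_eq`; this needs a partition of unity and truncation, since `f` need not
have compact support). As `A` for the amplitude `b χ` is multiplication by `χ` after `A` for
`b`, the value `(b χ)(x, D)v` does not depend on `χ`. If `T` extends `b(x, D)`, then `T ∘ χ(D)`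
extends `(b χ)(x, D)`, so the two are equal, and `χ(D)v = v` (`IsExtension.pdo_eq`).

For the support rule, let `ζ` lie outside `Σ(b, v)`. For a test function `φ`,
`⟨𝓕(b(x, D)v), φ⟩ = (2π)⁻ⁿ ⟨v̂, A φ̂⟩`, and formally `A φ̂ (η) = ⟨b̂(·, η), φ(· + η)⟩`. Rigorously, the integral
of `A φ̂` against `h` is the pairing of `b̂` with `φ(ξ + η) h(η)`
(`partialFourier_eq_integral`). If `φ` is supported near `ζ` and `h` near a point `η` of
`supp v̂`, then this function is supported near `(ζ - η, η)`, which is not in `supp b̂`, so the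
pairing is zero. Since `supp v̂` is compact, finitely many such neighbourhoods of points `η`
suffice, and `A φ̂` vanishes near `supp v̂` for all `φ` supported in one neighbourhood of `ζ`
(`dsupport_fourierD_pdo_subset`).
-/

/-! ### Mixed and total derivatives -/

namespace SupportRule

section Mixed

variable {V W : Type} [NormedAddCommGroup V] [NormedSpace ℝ V] [NormedAddCommGroup W]
  [NormedSpace ℝ W]

theorem contDiff_fderiv_apply_const {F : Type} [NormedAddCommGroup F] [NormedSpace ℝ F]
    {f : V → F} (hf : ContDiff ℝ ∞ f) (v : V) : ContDiff ℝ ∞ (fun p => fderiv ℝ f p v) :=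
  (hf.fderiv_right (m := ∞) (by simp)).clm_apply contDiff_const

/-- The last slot of an iterated derivative is an inner directional derivative. -/
theorem iteratedFDeriv_succ_apply_eq_fderiv_apply {F : Type} [NormedAddCommGroup F]
    [NormedSpace ℝ F] {f : V → F} (hf : ContDiff ℝ ∞ f) (m : ℕ) (p : V) (v : Fin (m + 1) → V) :
    iteratedFDeriv ℝ (m + 1) f p v
      = iteratedFDeriv ℝ m (fun q => fderiv ℝ f q (v (Fin.last m))) p (Fin.init v) := by
  rw [iteratedFDeriv_succ_apply_right]
  exact (iteratedFDeriv_clm_apply_const_apply (hf.fderiv_right (m := ∞) (by simp))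
    (mod_cast le_top)).symm

theorem norm_iteratedFDeriv_fderiv_apply_le {F : Type} [NormedAddCommGroup F] [NormedSpace ℝ F]
    {f : V → F} (hf : ContDiff ℝ ∞ f) (m : ℕ) (p v : V) :
    ‖iteratedFDeriv ℝ m (fun q => fderiv ℝ f q v) p‖ ≤ ‖v‖ * ‖iteratedFDeriv ℝ (m + 1) f p‖ := by
  rw [← norm_iteratedFDeriv_fderiv]
  refine (ContinuousLinearMap.norm_iteratedFDeriv_comp_left
    (ContinuousLinearMap.apply ℝ F v) (n := m) (N := ∞)
    (hf.fderiv_right (m := ∞) (by simp)).contDiffAt (mod_cast le_top)).trans ?_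
  gcongr
  refine ContinuousLinearMap.opNorm_le_bound _ (norm_nonneg _) fun L => ?_
  simpa [mul_comm] using L.le_opNorm v

/-- Directional derivatives of a smooth function commute. -/
theorem fderiv_fderiv_apply_comm {f : V → ℂ} (hf : ContDiff ℝ ∞ f) (p v w : V) :
    fderiv ℝ (fun q => fderiv ℝ f q v) p w = fderiv ℝ (fun q => fderiv ℝ f q w) p v := by
  have hd : DifferentiableAt ℝ (fderiv ℝ f) p :=
    ((hf.fderiv_right (m := ∞) (by simp)).differentiable (by simp)) p
  have h : IsSymmSndFDerivAt ℝ f p :=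
    hf.contDiffAt.isSymmSndFDerivAt
      (by simpa using (WithTop.coe_le_coe.2 le_top : ((2 : ℕ∞) : WithTop ℕ∞) ≤ ∞))
  rw [fderiv_clm_apply hd (differentiableAt_const v),
    fderiv_clm_apply hd (differentiableAt_const w)]
  simpa using h w v

theorem contDiff_comp_prodMk {F : Type} [NormedAddCommGroup F] [NormedSpace ℝ F] {B : V × W → F}
    (hB : ContDiff ℝ ∞ B) (y : V) : ContDiff ℝ ∞ (fun η => B (y, η)) :=
  hB.comp (contDiff_const.prodMk contDiff_id)

theorem contDiff_iteratedFDeriv_snd {B : V × W → ℂ} (hB : ContDiff ℝ ∞ B) (l : ℕ) (ξ : W) :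
    ContDiff ℝ ∞ (fun y => iteratedFDeriv ℝ l (fun η => B (y, η)) ξ) := by
  have h : (fun y => iteratedFDeriv ℝ l (fun η => B (y, η)) ξ) = fun y =>
      ContinuousMultilinearMap.compContinuousLinearMapL (𝕜 := ℝ) (F := ℂ)
        (fun _ : Fin l => ContinuousLinearMap.inr ℝ V W) (iteratedFDeriv ℝ l B (y, ξ)) := by
    ext1 y
    have h1 : (fun η => B (y, η))
        = (fun q => B (q + (y, 0))) ∘ (ContinuousLinearMap.inr ℝ V W) := by
      ext η; simp
    have h2 : ContDiff ℝ ∞ (fun q : V × W => B (q + (y, 0))) :=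
      hB.comp (contDiff_id.add contDiff_const)
    rw [h1, ContinuousLinearMap.iteratedFDeriv_comp_right (n := ∞) _ h2 ξ (mod_cast le_top),
      iteratedFDeriv_comp_add_right]
    simp
  rw [h]
  exact (ContinuousLinearMap.contDiff _).comp
    ((hB.iteratedFDeriv_right (m := ∞) (i := l) (by exact_mod_cast le_top)).comp
      (contDiff_id.prodMk contDiff_const))

theorem fderiv_snd_apply {B : V × W → ℂ} (hB : ContDiff ℝ ∞ B) (y : V) (η w : W) :
    fderiv ℝ (fun η => B (y, η)) η w = fderiv ℝ B (y, η) (0, w) := by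
  have h := HasFDerivAt.comp (f := fun η => (y, η)) η
    ((hB.differentiable (by simp)) (y, η)).hasFDerivAt (hasFDerivAt_prodMk_right y η)
  have := h.fderiv
  simp only [Function.comp_def] at this
  rw [this]
  rfl

theorem fderiv_fst_apply {B : V × W → ℂ} (hB : ContDiff ℝ ∞ B) (y u : V) (η : W) :
    fderiv ℝ (fun y => B (y, η)) y u = fderiv ℝ B (y, η) (u, 0) := by
  have h := HasFDerivAt.comp (f := fun y => (y, η)) y
    ((hB.differentiable (by simp)) (y, η)).hasFDerivAt (hasFDerivAt_prodMk_left y η)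
  have := h.fderiv
  simp only [Function.comp_def] at this
  rw [this]
  rfl

/-- A derivative in the first variable commutes with the iterated derivative in the second. -/
theorem fderiv_iteratedFDeriv_snd {B : V × W → ℂ} (hB : ContDiff ℝ ∞ B) (l : ℕ) (y u : V)
    (ξ : W) :
    iteratedFDeriv ℝ l (fun η => fderiv ℝ B (y, η) (u, 0)) ξ
      = fderiv ℝ (fun y => iteratedFDeriv ℝ l (fun η => B (y, η)) ξ) y u := by
  induction l generalizing B with
  | zero =>
    ext w
    have h := fderiv_continuousMultilinear_apply_const_apply
      ((contDiff_iteratedFDeriv_snd hB 0 ξ).differentiable (by simp) y) w u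
    rw [← h]
    simp [fderiv_fst_apply hB]
  | succ l ih =>
    ext w
    have hu : ContDiff ℝ ∞ (fun q => fderiv ℝ B q (u, 0)) := contDiff_fderiv_apply_const hB _
    have hw : ContDiff ℝ ∞ (fun q => fderiv ℝ B q (0, w (Fin.last l))) :=
      contDiff_fderiv_apply_const hB _
    have h := fderiv_continuousMultilinear_apply_const_apply
      ((contDiff_iteratedFDeriv_snd hB (l + 1) ξ).differentiable (by simp) y) w u
    have h' := fderiv_continuousMultilinear_apply_const_apply
      ((contDiff_iteratedFDeriv_snd hw l ξ).differentiable (by simp) y) (Fin.init w) u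
    rw [← h, iteratedFDeriv_succ_apply_eq_fderiv_apply (contDiff_comp_prodMk hu y)]
    have e1 : (fun q => fderiv ℝ (fun η => fderiv ℝ B (y, η) (u, 0)) q
        (w (Fin.last l))) = fun η => fderiv ℝ (fun q => fderiv ℝ B q (0, w (Fin.last l)))
          (y, η) (u, 0) := by
      ext η
      rw [← fderiv_fderiv_apply_comm hB]
      exact fderiv_snd_apply hu y η _
    rw [e1, ih hw, ← h']
    congr 2
    ext z
    rw [iteratedFDeriv_succ_apply_eq_fderiv_apply (contDiff_comp_prodMk hB z)]
    congr 2
    ext η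
    exact (fderiv_snd_apply hB z η _).symm

/-- The `m`-th total derivative at a point is controlled by the mixed partial derivatives of order
`m`: expand each argument into its two components and move the first variable outwards by the
symmetry of second derivatives. -/
theorem norm_iteratedFDeriv_le_of_mixed {B : V × W → ℂ} (hB : ContDiff ℝ ∞ B) (m : ℕ) (x : V)
    (ξ : W) {M : ℝ} (hM : ∀ k l, k + l = m →
      ‖iteratedFDeriv ℝ k (fun y => iteratedFDeriv ℝ l (fun η => B (y, η)) ξ) x‖ ≤ M) :
    ‖iteratedFDeriv ℝ m B (x, ξ)‖ ≤ 2 ^ m * M := by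
  induction m generalizing B M with
  | zero =>
    have := hM 0 0 rfl
    simpa using this
  | succ m ih =>
    have hM0 : 0 ≤ M := (norm_nonneg _).trans (hM 0 (m + 1) (by simp))
    refine ContinuousMultilinearMap.opNorm_le_bound (by positivity) fun v => ?_
    set u := (v (Fin.last m)).1
    set w := (v (Fin.last m)).2
    have hu : ContDiff ℝ ∞ (fun q => fderiv ℝ B q (u, 0)) := contDiff_fderiv_apply_const hB _
    have hw : ContDiff ℝ ∞ (fun q => fderiv ℝ B q (0, w)) := contDiff_fderiv_apply_const hB _
    have iu := ih hu (M := ‖u‖ * M) fun k l hkl => by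
      simp_rw [fderiv_iteratedFDeriv_snd hB]
      refine (norm_iteratedFDeriv_fderiv_apply_le (contDiff_iteratedFDeriv_snd hB l ξ) k x u).trans
        ?_
      gcongr
      exact hM _ _ (by omega)
    -- The derivative in the direction `w` fills the innermost slot, which the bounded linear map
    -- `L` inserts into the next higher derivative in `ξ`.
    have iw := ih hw (M := ‖w‖ * M) fun k l hkl => by
      have hL : ∃ L : (ContinuousMultilinearMap ℝ (fun _ : Fin (l + 1) => W) ℂ) →L[ℝ]
          (ContinuousMultilinearMap ℝ (fun _ : Fin l => W) ℂ), ‖L‖ ≤ ‖w‖ ∧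
          ∀ T z, L T z = T (Fin.snoc z w) := by
        refine ⟨((ContinuousLinearMap.compContinuousMultilinearMapL ℝ (fun _ : Fin l => W)
          (W →L[ℝ] ℂ) ℂ) (ContinuousLinearMap.apply ℝ ℂ w)).comp
          ((continuousMultilinearCurryRightEquiv' ℝ l W ℂ).toContinuousLinearEquiv :
            _ →L[ℝ] _), ?_, fun T z => rfl⟩
        refine ContinuousLinearMap.opNorm_le_bound _ (norm_nonneg _) fun T => ?_
        refine ContinuousMultilinearMap.opNorm_le_bound (by positivity) fun z => ?_
        change ‖T (Fin.snoc z w)‖ ≤ _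
        refine (T.le_opNorm _).trans (le_of_eq ?_)
        rw [Fin.prod_univ_castSucc]
        simp
        ring
      obtain ⟨L, hLn, hL⟩ := hL
      have e : (fun y => iteratedFDeriv ℝ l (fun η => fderiv ℝ B (y, η) (0, w)) ξ)
          = L ∘ fun y => iteratedFDeriv ℝ (l + 1) (fun η => B (y, η)) ξ := by
        ext y z
        rw [Function.comp_apply, hL,
          iteratedFDeriv_succ_apply_eq_fderiv_apply (contDiff_comp_prodMk hB y)]
        simp only [Fin.snoc_last, Fin.init_snoc]
        congr 2
        ext η
        exact (fderiv_snd_apply hB y η w).symm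
      rw [e]
      refine (L.norm_iteratedFDeriv_comp_left (N := ∞)
        (contDiff_iteratedFDeriv_snd hB (l + 1) ξ).contDiffAt (mod_cast le_top)).trans ?_
      gcongr
      exact hM _ _ (by omega)
    have e : (fun q => fderiv ℝ B q (v (Fin.last m)))
        = (fun q => fderiv ℝ B q (u, 0)) + (fun q => fderiv ℝ B q (0, w)) := by
      ext q
      rw [Pi.add_apply, ← map_add]
      simp [u, w]
    have hun : ‖u‖ ≤ ‖v (Fin.last m)‖ := norm_fst_le _
    have hwn : ‖w‖ ≤ ‖v (Fin.last m)‖ := norm_snd_le _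
    rw [iteratedFDeriv_succ_apply_eq_fderiv_apply hB, e, iteratedFDeriv_add_apply
      (hu.of_le (mod_cast le_top)).contDiffAt (hw.of_le (mod_cast le_top)).contDiffAt,
      Fin.prod_univ_castSucc]
    set P := ∏ i : Fin m, ‖v i.castSucc‖
    have hP : 0 ≤ P := by positivity
    have b1 := ((iteratedFDeriv ℝ m (fun q => fderiv ℝ B q (u, 0)) (x, ξ)).le_opNorm
      (Fin.init v)).trans (mul_le_mul_of_nonneg_right iu hP)
    have b2 := ((iteratedFDeriv ℝ m (fun q => fderiv ℝ B q (0, w)) (x, ξ)).le_opNorm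
      (Fin.init v)).trans (mul_le_mul_of_nonneg_right iw hP)
    refine (norm_add_le _ _).trans ((add_le_add b1 b2).trans ?_)
    calc 2 ^ m * (‖u‖ * M) * P + 2 ^ m * (‖w‖ * M) * P
        ≤ 2 ^ m * (‖v (Fin.last m)‖ * M) * P + 2 ^ m * (‖v (Fin.last m)‖ * M) * P := by gcongr
      _ = 2 ^ (m + 1) * M * (P * ‖v (Fin.last m)‖) := by ring

end Mixed

/-! ### Amplitudes -/

/-- An amplitude of order `N`: a smooth function all of whose derivatives grow at most like
`(1 + |ξ|) ^ N`, with the same `N` for all of them. Both the symbols in `S^d_{1,0}` and the products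
`b χ` with `b` in `S^d_{1,1}` and `χ = χ(ξ)` a cut-off are of this kind. -/
structure IsAmplitude {V W : Type} [NormedAddCommGroup V] [NormedSpace ℝ V] [NormedAddCommGroup W]
    [NormedSpace ℝ W] (N : ℕ) (B : V × W → ℂ) : Prop where
  contDiff : ContDiff ℝ ∞ B
  bound : ∀ m : ℕ, ∃ C : ℝ, 0 ≤ C ∧ ∀ p, ‖iteratedFDeriv ℝ m B p‖ ≤ C * (1 + ‖p.2‖) ^ N

namespace IsAmplitude

variable {V W : Type} [NormedAddCommGroup V] [NormedSpace ℝ V] [NormedAddCommGroup W]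
  [NormedSpace ℝ W] {N : ℕ} {B : V × W → ℂ}

theorem norm_le (hB : IsAmplitude N B) : ∃ C : ℝ, 0 ≤ C ∧ ∀ p, ‖B p‖ ≤ C * (1 + ‖p.2‖) ^ N := by
  simpa using hB.bound 0

theorem norm_fderiv_le (hB : IsAmplitude N B) :
    ∃ C : ℝ, 0 ≤ C ∧ ∀ p, ‖fderiv ℝ B p‖ ≤ C * (1 + ‖p.2‖) ^ N := by
  simpa using hB.bound 1

theorem fderiv_apply (hB : IsAmplitude N B) (v : V × W) :
    IsAmplitude N (fun p => fderiv ℝ B p v) where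
  contDiff := contDiff_fderiv_apply_const hB.contDiff v
  bound m := by
    obtain ⟨C, hC, h⟩ := hB.bound (m + 1)
    refine ⟨‖v‖ * C, by positivity, fun p => ?_⟩
    refine (norm_iteratedFDeriv_fderiv_apply_le hB.contDiff m p v).trans ?_
    rw [mul_assoc]
    gcongr
    exact h p

end IsAmplitude

/-! ### Symbols as amplitudes -/

section Symbols

variable {n : ℕ} {d ρ δ : ℝ} {b : EuclideanSpace ℝ (Fin n) → EuclideanSpace ℝ (Fin n) → ℂ}

theorem IsSymbol.mono_right {δ' : ℝ} (hb : IsSymbol d ρ δ b) (hδ : δ ≤ δ') :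
    IsSymbol d ρ δ' b := by
  refine ⟨hb.1, fun k l => ?_⟩
  obtain ⟨C, hC⟩ := hb.2 k l
  refine ⟨|C|, fun x ξ => (hC x ξ).trans ?_⟩
  have h1 : 1 ≤ 1 + ‖ξ‖ := by simp
  exact mul_le_mul (le_abs_self C) (Real.rpow_le_rpow_of_exponent_le h1 (by gcongr)) (by positivity)
    (abs_nonneg C)

/-- Each derivative in `x` costs `δ` powers of `1 + |ξ|`, so that the exponent `N` depends on the
order `m` of differentiation unless `δ = 0`. -/
theorem IsSymbol.exists_norm_iteratedFDeriv_le (hb : IsSymbol d ρ δ b) (hρ : 0 ≤ ρ) (hδ : 0 ≤ δ)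
    (m N : ℕ) (hN : d + δ * m ≤ N) : ∃ C : ℝ, 0 ≤ C ∧
      ∀ p : EuclideanSpace ℝ (Fin n) × EuclideanSpace ℝ (Fin n),
        ‖iteratedFDeriv ℝ m (fun p : EuclideanSpace ℝ (Fin n) × EuclideanSpace ℝ (Fin n) =>
          b p.1 p.2) p‖ ≤ C * (1 + ‖p.2‖) ^ N := by
  choose C hC using hb.2
  refine ⟨2 ^ m * ∑ kl ∈ Finset.HasAntidiagonal.antidiagonal m, |C kl.1 kl.2|, by positivity,
    fun ⟨x, ξ⟩ => ?_⟩
  rw [mul_assoc]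
  refine norm_iteratedFDeriv_le_of_mixed hb.1 m x ξ fun k l hkl => ?_
  refine (hC k l x ξ).trans ?_
  have h1 : 1 ≤ 1 + ‖ξ‖ := by simp
  have h2 : |C k l| ≤ ∑ kl ∈ Finset.HasAntidiagonal.antidiagonal m, |C kl.1 kl.2| :=
    Finset.single_le_sum (f := fun kl : ℕ × ℕ => |C kl.1 kl.2|) (fun _ _ => abs_nonneg _)
      (Finset.HasAntidiagonal.mem_antidiagonal.2 hkl : (k, l) ∈ _)
  have h3 : (1 + ‖ξ‖) ^ (d - ρ * l + δ * k) ≤ (1 + ‖ξ‖) ^ N := by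
    rw [← Real.rpow_natCast]
    refine Real.rpow_le_rpow_of_exponent_le h1 (le_trans ?_ hN)
    have : δ * k ≤ δ * m := by gcongr; omega
    have : 0 ≤ ρ * l := by positivity
    linarith
  exact mul_le_mul ((le_abs_self _).trans h2) h3 (by positivity)
    (Finset.sum_nonneg fun _ _ => abs_nonneg _)

theorem IsSymbol.isAmplitude (hb : IsSymbol d ρ 0 b) (hρ : 0 ≤ ρ) :
    IsAmplitude ⌈d⌉₊ (fun p : EuclideanSpace ℝ (Fin n) × EuclideanSpace ℝ (Fin n) =>
      b p.1 p.2) where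
  contDiff := hb.1
  bound m := hb.exists_norm_iteratedFDeriv_le hρ le_rfl m _ (by simpa using Nat.le_ceil d)

/-- A cut-off in `ξ` turns a symbol of type `ρ, δ` into an amplitude of order `0`: on the support
of `χ` all the weights are bounded. -/
theorem IsSymbol.isAmplitude_mul (hb : IsSymbol d ρ δ b) (hρ : 0 ≤ ρ) (hδ : 0 ≤ δ)
    {χ : EuclideanSpace ℝ (Fin n) → ℂ} (hχ : ContDiff ℝ ∞ χ) (hχc : HasCompactSupport χ) :
    IsAmplitude 0 (fun p : EuclideanSpace ℝ (Fin n) × EuclideanSpace ℝ (Fin n) =>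
      b p.1 p.2 * χ p.2) where
  contDiff := hb.1.mul (hχ.comp contDiff_snd)
  bound m := by
    -- On the compact support of `χ` the derivatives of `χ` absorb every power of `1 + |ξ|`.
    have hχ2 : ∀ j N : ℕ, ∃ C : ℝ, 0 ≤ C ∧ ∀ p : EuclideanSpace ℝ (Fin n) ×
        EuclideanSpace ℝ (Fin n), (1 + ‖p.2‖) ^ N * ‖iteratedFDeriv ℝ j (χ ∘ Prod.snd) p‖ ≤ C := by
      intro j N
      refine ⟨_, by positivity, fun p => le_trans ?_ (SchwartzMap.one_add_le_sup_seminorm_apply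
        (𝕜 := ℝ) (m := (N, j)) le_rfl le_rfl (hχc.toSchwartzMap hχ) p.2)⟩
      gcongr
      have h := (ContinuousLinearMap.snd ℝ (EuclideanSpace ℝ (Fin n))
        (EuclideanSpace ℝ (Fin n))).iteratedFDeriv_comp_right (n := ∞) hχ p (i := j)
        (mod_cast le_top)
      rw [ContinuousLinearMap.coe_snd'] at h
      rw [h]
      refine (ContinuousMultilinearMap.norm_compContinuousLinearMap_le _ _).trans ?_
      exact mul_le_of_le_one_right (norm_nonneg _) (Finset.prod_le_one
        (fun _ _ => norm_nonneg _) fun _ _ => ContinuousLinearMap.norm_snd_le ..)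
    choose C hC0 hC using fun i : ℕ =>
      hb.exists_norm_iteratedFDeriv_le hρ hδ i _ (Nat.le_ceil (d + δ * i))
    choose D hD0 hD using hχ2
    refine ⟨∑ i ∈ Finset.range (m + 1), (m.choose i : ℝ) * (C i * D (m - i) ⌈d + δ * i⌉₊),
      Finset.sum_nonneg fun i _ => by have := hC0 i; have := hD0 (m - i) ⌈d + δ * i⌉₊; positivity,
      fun p => ?_⟩
    refine (norm_iteratedFDeriv_mul_le (N := ∞) hb.1 (hχ.comp contDiff_snd) p
      (mod_cast le_top)).trans ?_
    rw [pow_zero, mul_one]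
    refine Finset.sum_le_sum fun i _ => ?_
    rw [mul_assoc]
    refine mul_le_mul_of_nonneg_left ?_ (by positivity)
    calc _ ≤ (C i * (1 + ‖p.2‖) ^ ⌈d + δ * i⌉₊) * ‖iteratedFDeriv ℝ (m - i) (χ ∘ Prod.snd) p‖ := by
          gcongr
          exact hC i p
      _ = C i * ((1 + ‖p.2‖) ^ ⌈d + δ * i⌉₊ * ‖iteratedFDeriv ℝ (m - i) (χ ∘ Prod.snd) p‖) := by
          ring
      _ ≤ _ := mul_le_mul_of_nonneg_left (hD _ _ p) (hC0 i)

end Symbols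

end SupportRule

/-! ### Oscillatory integrals in the space variable -/

namespace SupportRule

section Preliminaries

variable {E : Type} [NormedAddCommGroup E] [InnerProductSpace ℝ E]

/-- Multiplication by the linear function `x ↦ x·w` on the Schwartz space. -/
noncomputable def mulInnerCLM (w : E) : 𝓢(E, ℂ) →L[ℂ] 𝓢(E, ℂ) :=
  SchwartzMap.smulLeftCLM ℂ (fun x => ((inner ℝ x w : ℝ) : ℂ))

theorem mulInnerCLM_apply (w : E) (φ : 𝓢(E, ℂ)) (x : E) :
    mulInnerCLM w φ x = (inner ℝ x w : ℝ) * φ x := by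
  rw [mulInnerCLM, SchwartzMap.smulLeftCLM_apply_apply]
  · rfl
  · exact Function.Complex.hasTemperateGrowth_ofReal.comp
      (Function.hasTemperateGrowth_inner_left w)

theorem hasFDerivAt_exp_inner_right (x ξ : E) :
    HasFDerivAt (fun η : E => Complex.exp (Complex.I * (inner ℝ x η : ℝ)))
      ((Complex.exp (Complex.I * (inner ℝ x ξ : ℝ)) * Complex.I) •
        Complex.ofRealCLM.comp (innerSL ℝ x)) ξ := by
  have h : HasFDerivAt (fun η : E => ((inner ℝ x η : ℝ) : ℂ))
      (Complex.ofRealCLM.comp (innerSL ℝ x)) ξ :=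
    (Complex.ofRealCLM.comp (innerSL ℝ x)).hasFDerivAt
  have := (h.const_mul Complex.I).cexp
  rwa [smul_smul] at this

theorem hasFDerivAt_exp_inner_left (x ξ : E) :
    HasFDerivAt (fun y : E => Complex.exp (Complex.I * (inner ℝ y ξ : ℝ)))
      ((Complex.exp (Complex.I * (inner ℝ x ξ : ℝ)) * Complex.I) •
        Complex.ofRealCLM.comp (innerSL ℝ ξ)) x := by
  simpa only [real_inner_comm] using hasFDerivAt_exp_inner_right ξ x

variable [FiniteDimensional ℝ E]

theorem fderiv_eq_sum_smulRight (f : E → ℂ) :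
    fderiv ℝ f = fun ξ => ∑ j, (ContinuousLinearMap.smulRightL ℝ E ℂ
      (innerSL ℝ (stdOrthonormalBasis ℝ E j))) (fderiv ℝ f ξ (stdOrthonormalBasis ℝ E j)) := by
  ext ξ w
  conv_lhs => rw [← (stdOrthonormalBasis ℝ E).sum_repr' w]
  simp [map_sum]

theorem norm_iteratedFDeriv_succ_le_sum {f : E → ℂ} (hf : ContDiff ℝ ∞ f) (l : ℕ) (ξ : E) :
    ‖iteratedFDeriv ℝ (l + 1) f ξ‖ ≤ ∑ j, ‖iteratedFDeriv ℝ l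
      (fun η => fderiv ℝ f η (stdOrthonormalBasis ℝ E j)) ξ‖ := by
  have hj : ∀ j, ContDiff ℝ ∞ (fun η => fderiv ℝ f η (stdOrthonormalBasis ℝ E j)) := fun j =>
    contDiff_fderiv_apply_const hf _
  rw [← norm_iteratedFDeriv_fderiv]
  nth_rw 1 [fderiv_eq_sum_smulRight f]
  rw [iteratedFDeriv_sum (f := fun j ξ => ContinuousLinearMap.smulRightL ℝ E ℂ
      (innerSL ℝ (stdOrthonormalBasis ℝ E j)) (fderiv ℝ f ξ (stdOrthonormalBasis ℝ E j)))
      fun j _ => ((ContinuousLinearMap.contDiff _).comp (hj j)).of_le (mod_cast le_top),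
    Finset.sum_apply]
  refine (norm_sum_le _ _).trans (Finset.sum_le_sum fun j _ => ?_)
  refine (ContinuousLinearMap.norm_iteratedFDeriv_comp_left (N := ∞) _ (hj j).contDiffAt
    (mod_cast le_top)).trans ?_
  refine mul_le_of_le_one_left (norm_nonneg _) (ContinuousLinearMap.opNorm_le_bound _ zero_le_one
    fun c => ?_)
  simp [ContinuousLinearMap.norm_smulRight_apply]

end Preliminaries

section Oscillatory

variable {E : Type} [NormedAddCommGroup E] [InnerProductSpace ℝ E] [FiniteDimensional ℝ E]
  [MeasurableSpace E] [BorelSpace E]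

/-- The function `ξ ↦ ∫ e^{i x·ξ} B(x, ξ) φ(x) dx`. Up to the Fourier transform this is the
transpose of the operator with amplitude `B` applied to `φ`. -/
noncomputable def oscIntegral (B : E × E → ℂ) (φ : 𝓢(E, ℂ)) (ξ : E) : ℂ :=
  ∫ x, Complex.exp (Complex.I * (inner ℝ x ξ : ℝ)) * B (x, ξ) * φ x

section Calculus

variable {N : ℕ} {B : E × E → ℂ}

theorem integrable_oscIntegrand (hB : IsAmplitude N B) (φ : 𝓢(E, ℂ)) (ξ : E) :
    Integrable (fun x => Complex.exp (Complex.I * (inner ℝ x ξ : ℝ)) * B (x, ξ) * φ x) := by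
  obtain ⟨C, hC, h⟩ := hB.norm_le
  have hBc := hB.contDiff.continuous
  refine (φ.integrable.norm.const_mul (C * (1 + ‖ξ‖) ^ N)).mono' ?_ ?_
  · exact (by fun_prop : Continuous _).aestronglyMeasurable
  · refine .of_forall fun x => ?_
    rw [norm_mul, norm_mul, Complex.norm_exp_I_mul_ofReal, one_mul]
    gcongr
    exact h (x, ξ)

theorem norm_oscIntegral_le (hB : IsAmplitude N B) :
    ∃ C : ℝ, 0 ≤ C ∧ ∀ (φ : 𝓢(E, ℂ)) ξ,
      ‖oscIntegral B φ ξ‖ ≤ (C * ∫ x, ‖φ x‖) * (1 + ‖ξ‖) ^ N := by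
  obtain ⟨C, hC, h⟩ := hB.norm_le
  refine ⟨C, hC, fun φ ξ => ?_⟩
  calc ‖oscIntegral B φ ξ‖ ≤ ∫ x, (C * (1 + ‖ξ‖) ^ N) * ‖φ x‖ := by
        refine norm_integral_le_of_norm_le (φ.integrable.norm.const_mul _) (.of_forall fun x => ?_)
        rw [norm_mul, norm_mul, Complex.norm_exp_I_mul_ofReal, one_mul]
        gcongr
        exact h (x, ξ)
    _ = _ := by rw [integral_const_mul]; ring

theorem oscIntegral_add (hB : IsAmplitude N B) (φ ψ : 𝓢(E, ℂ)) (ξ : E) :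
    oscIntegral B (φ + ψ) ξ = oscIntegral B φ ξ + oscIntegral B ψ ξ := by
  rw [oscIntegral, oscIntegral, oscIntegral, ← integral_add (integrable_oscIntegrand hB φ ξ)
    (integrable_oscIntegrand hB ψ ξ)]
  simp [mul_add]

theorem oscIntegral_smul (a : ℂ) (φ : 𝓢(E, ℂ)) (ξ : E) :
    oscIntegral B (a • φ) ξ = a * oscIntegral B φ ξ := by
  rw [oscIntegral, oscIntegral, ← integral_const_mul]
  congr 1
  ext x
  simp only [smul_apply, smul_eq_mul]
  ring

/-- Differentiation under the integral: a derivative in `ξ` falls on the amplitude or multiplies `φ`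
by `i x·w`, and so gives integrals of the same kind. -/
theorem hasFDerivAt_oscIntegral (hB : IsAmplitude N B) (φ : 𝓢(E, ℂ)) (ξ : E) :
    ∃ L : E →L[ℝ] ℂ, HasFDerivAt (oscIntegral B φ) L ξ ∧ ∀ w, L w =
      oscIntegral (fun p => fderiv ℝ B p (0, w)) φ ξ
        + Complex.I * oscIntegral B (mulInnerCLM w φ) ξ := by
  obtain ⟨C, hC, hC'⟩ := hB.norm_le
  obtain ⟨D, hD, hD'⟩ := hB.norm_fderiv_le
  have hBc := hB.contDiff.continuous
  have hBd : Continuous (fderiv ℝ B) := hB.contDiff.continuous_fderiv (by simp)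
  let F' : E → E → E →L[ℝ] ℂ := fun η x => φ x •
    (Complex.exp (Complex.I * (inner ℝ x η : ℝ)) •
      (fderiv ℝ B (x, η)).comp (ContinuousLinearMap.inr ℝ E E)
    + B (x, η) • ((Complex.exp (Complex.I * (inner ℝ x η : ℝ)) * Complex.I) •
        Complex.ofRealCLM.comp (innerSL ℝ x)))
  have hcont : Continuous (F' ξ) := by
    have h1 : Continuous fun x : E => (fderiv ℝ B (x, ξ)).comp (ContinuousLinearMap.inr ℝ E E) :=
      (hBd.comp (by fun_prop)).clm_comp continuous_const
    have h2 : Continuous fun x : E => Complex.ofRealCLM.comp (innerSL ℝ x) :=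
      continuous_const.clm_comp (innerSL ℝ).continuous
    fun_prop
  -- A bound for `(1 + |η|) ^ N` on the unit ball around `ξ`.
  let K : ℝ := (1 + (‖ξ‖ + 1)) ^ N
  have hbd : ∀ x, ∀ η ∈ Metric.ball ξ 1, ‖F' η x‖ ≤ K * D * ‖φ x‖ + K * C * (‖x‖ * ‖φ x‖) := by
    intro x η hη
    have hη' : ‖η‖ ≤ ‖ξ‖ + 1 := by
      have := norm_sub_norm_le η ξ
      rw [Metric.mem_ball, dist_eq_norm] at hη
      linarith
    have hK : (1 + ‖η‖) ^ N ≤ K := pow_le_pow_left₀ (by positivity) (by linarith) N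
    have e1 : ‖(fderiv ℝ B (x, η)).comp (ContinuousLinearMap.inr ℝ E E)‖ ≤ D * K :=
      calc _ ≤ ‖fderiv ℝ B (x, η)‖ * ‖ContinuousLinearMap.inr ℝ E E‖ :=
            ContinuousLinearMap.opNorm_comp_le _ _
        _ ≤ (D * (1 + ‖η‖) ^ N) * 1 :=
            mul_le_mul (hD' _) (ContinuousLinearMap.norm_inr_le_one ℝ E E)
              (norm_nonneg (ContinuousLinearMap.inr ℝ E E))
              (by positivity)
        _ ≤ D * K := by rw [mul_one]; gcongr
    have e2 : ‖Complex.ofRealCLM.comp (innerSL ℝ x)‖ ≤ ‖x‖ := by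
      refine (ContinuousLinearMap.opNorm_comp_le _ _).trans ?_
      rw [Complex.ofRealCLM_norm, one_mul, innerSL_apply_norm]
    have e3 : ‖B (x, η)‖ ≤ C * K := (hC' _).trans (by gcongr)
    calc ‖F' η x‖ ≤ ‖φ x‖ * (D * K + C * K * ‖x‖) := by
          rw [norm_smul]
          gcongr
          refine (norm_add_le _ _).trans ?_
          rw [norm_smul, norm_smul, norm_smul, norm_mul, Complex.norm_exp_I_mul_ofReal,
            Complex.norm_I, one_mul, one_mul, one_mul]
          gcongr
      _ = _ := by ring
  have hbi : Integrable (fun x => K * D * ‖φ x‖ + K * C * (‖x‖ * ‖φ x‖)) := by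
    refine (φ.integrable.norm.const_mul _).add (Integrable.const_mul ?_ _)
    simpa using φ.integrable_pow_mul volume 1
  have hF'i : Integrable (F' ξ) :=
    hbi.mono' hcont.aestronglyMeasurable
      (.of_forall fun x => hbd x ξ (Metric.mem_ball_self one_pos))
  refine ⟨∫ x, F' ξ x, ?_, fun w => ?_⟩
  · refine hasFDerivAt_integral_of_dominated_of_fderiv_le (𝕜 := ℝ)
      (Metric.ball_mem_nhds ξ one_pos)
      (.of_forall fun η => (integrable_oscIntegrand hB φ η).aestronglyMeasurable)
      (integrable_oscIntegrand hB φ ξ) hcont.aestronglyMeasurable (.of_forall hbd) hbi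
      (.of_forall fun x η _ => ?_)
    have h1 : HasFDerivAt (fun η => B (x, η))
        ((fderiv ℝ B (x, η)).comp (ContinuousLinearMap.inr ℝ E E)) η :=
      HasFDerivAt.comp (f := fun η => (x, η)) η
        ((hB.contDiff.differentiable (by simp)) (x, η)).hasFDerivAt (hasFDerivAt_prodMk_right x η)
    exact ((hasFDerivAt_exp_inner_right x η).mul h1).mul_const (φ x)
  · rw [ContinuousLinearMap.integral_apply hF'i, oscIntegral, oscIntegral, ← integral_const_mul,
      ← integral_add (integrable_oscIntegrand (hB.fderiv_apply _) φ ξ)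
        ((integrable_oscIntegrand hB (mulInnerCLM w φ) ξ).const_mul _)]
    congr 1
    ext x
    simp [F', mulInnerCLM_apply]
    ring

theorem differentiable_oscIntegral (hB : IsAmplitude N B) (φ : 𝓢(E, ℂ)) :
    Differentiable ℝ (oscIntegral B φ) := fun ξ =>
  let ⟨_, h, _⟩ := hasFDerivAt_oscIntegral hB φ ξ
  h.differentiableAt

theorem fderiv_oscIntegral_apply (hB : IsAmplitude N B) (φ : 𝓢(E, ℂ)) (ξ w : E) :
    fderiv ℝ (oscIntegral B φ) ξ w = oscIntegral (fun p => fderiv ℝ B p (0, w)) φ ξ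
      + Complex.I * oscIntegral B (mulInnerCLM w φ) ξ := by
  obtain ⟨L, h, hL⟩ := hasFDerivAt_oscIntegral hB φ ξ
  rw [h.fderiv, hL]

open scoped LineDeriv in
/-- Integration by parts: a factor `i ξ·w` becomes a derivative of the amplitude or of `φ`. -/
theorem inner_mul_oscIntegral (hB : IsAmplitude N B) (φ : 𝓢(E, ℂ)) (ξ w : E) :
    (inner ℝ w ξ : ℝ) * oscIntegral B φ ξ =
      Complex.I * (oscIntegral (fun p => fderiv ℝ B p (w, 0)) φ ξ
        + oscIntegral B (∂_{w} φ) ξ) := by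
  let f : E → ℂ := fun x => Complex.exp (Complex.I * (inner ℝ x ξ : ℝ))
  let g : E → ℂ := fun x => B (x, ξ) * φ x
  have hf : ∀ x, HasFDerivAt f ((Complex.exp (Complex.I * (inner ℝ x ξ : ℝ)) * Complex.I) •
        Complex.ofRealCLM.comp (innerSL ℝ ξ)) x := fun x => hasFDerivAt_exp_inner_left x ξ
  have hg : ∀ x, HasFDerivAt g (B (x, ξ) • fderiv ℝ φ x +
      φ x • (fderiv ℝ B (x, ξ)).comp (ContinuousLinearMap.inl ℝ E E)) x := fun x =>
    (HasFDerivAt.comp (f := fun x => (x, ξ)) x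
      ((hB.contDiff.differentiable (by simp)) (x, ξ)).hasFDerivAt
        (hasFDerivAt_prodMk_left x ξ)).mul (φ.hasFDerivAt x)
  have hf' : ∀ x, fderiv ℝ f x w * g x = (Complex.I * (inner ℝ w ξ : ℝ)) *
      (Complex.exp (Complex.I * (inner ℝ x ξ : ℝ)) * B (x, ξ) * φ x) := by
    intro x
    rw [(hf x).fderiv]
    simp [g, real_inner_comm]
    ring
  have hg' : ∀ x, f x * fderiv ℝ g x w =
      Complex.exp (Complex.I * (inner ℝ x ξ : ℝ)) * (fderiv ℝ B (x, ξ) (w, 0)) * φ x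
      + Complex.exp (Complex.I * (inner ℝ x ξ : ℝ)) * B (x, ξ) * (∂_{w} φ) x := by
    intro x
    rw [(hg x).fderiv]
    simp [f, SchwartzMap.lineDerivOp_apply_eq_fderiv]
    ring
  have i1 := integrable_oscIntegrand (hB.fderiv_apply (w, 0)) φ ξ
  have i2 := integrable_oscIntegrand hB (∂_{w} φ) ξ
  have i3 := integrable_oscIntegrand hB φ ξ
  have key := integral_mul_fderiv_eq_neg_fderiv_mul_of_integrable (μ := (volume : Measure E))
    (f := f) (g := g) (v := w)
    (by simp_rw [hf']; exact i3.const_mul _) (by simp_rw [hg']; exact i1.add i2)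
    (by simpa only [f, g, mul_assoc] using i3)
    (fun x _ => (hf x).differentiableAt) (fun x _ => (hg x).differentiableAt)
  simp_rw [hf', hg'] at key
  rw [integral_add i1 i2, integral_const_mul] at key
  change oscIntegral (fun p => fderiv ℝ B p (w, 0)) φ ξ + oscIntegral B (∂_{w} φ) ξ
    = -(Complex.I * (inner ℝ w ξ : ℝ) * oscIntegral B φ ξ) at key
  rw [key]
  linear_combination ((inner ℝ w ξ : ℝ) * oscIntegral B φ ξ) * Complex.I_sq

theorem contDiff_oscIntegral (hB : IsAmplitude N B) (φ : 𝓢(E, ℂ)) :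
    ContDiff ℝ ∞ (oscIntegral B φ) := by
  rw [contDiff_infty]
  intro m
  induction m generalizing B φ with
  | zero => exact contDiff_zero.2 (differentiable_oscIntegral hB φ).continuous
  | succ m ih =>
    have hm : ((m + 1 : ℕ) : WithTop ℕ∞) = (m : WithTop ℕ∞) + 1 := by norm_cast
    rw [hm, contDiff_succ_iff_fderiv]
    refine ⟨differentiable_oscIntegral hB φ, by simp, ?_⟩
    rw [fderiv_eq_sum_smulRight]
    refine ContDiff.sum fun j _ => (ContinuousLinearMap.contDiff _).comp ?_
    simp_rw [fderiv_oscIntegral_apply hB]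
    exact (ih (hB.fderiv_apply _) φ).add (contDiff_const.mul (ih hB _))

end Calculus

/-! ### Continuity on the Schwartz space -/

section Continuity

open scoped LineDeriv

variable {N : ℕ} {B : E × E → ℂ}

/-- By `k` integrations by parts the integral gains the decay `(1 + |ξ|) ^ (-k)`, against the fixed
growth `(1 + |ξ|) ^ N` of the amplitude and all its derivatives. -/
theorem exists_seminorm_pow_mul_norm_oscIntegral_le (k : ℕ) (hB : IsAmplitude N B) :
    ∃ p : Seminorm ℂ 𝓢(E, ℂ), Continuous p ∧ ∀ φ ξ,
      (1 + ‖ξ‖) ^ k * ‖oscIntegral B φ ξ‖ ≤ p φ * (1 + ‖ξ‖) ^ N := by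
  induction k generalizing B with
  | zero =>
    obtain ⟨C, hC, h⟩ := norm_oscIntegral_le hB
    refine ⟨C.toNNReal • (normSeminorm ℂ (Lp ℂ 1 (volume : Measure E))).comp
      (SchwartzMap.toLpCLM ℂ ℂ 1 volume : 𝓢(E, ℂ) →L[ℂ] Lp ℂ 1 volume).toLinearMap, ?_,
      fun φ ξ => ?_⟩
    · exact (continuous_norm.comp
        (SchwartzMap.toLpCLM ℂ ℂ 1 volume : 𝓢(E, ℂ) →L[ℂ] Lp ℂ 1 volume).continuous).const_smul _
    · have e : ‖SchwartzMap.toLpCLM ℂ ℂ 1 volume φ‖ = ∫ x, ‖φ x‖ := SchwartzMap.norm_toLp_one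
      have h' := h φ ξ
      rw [← e] at h'
      simpa [NNReal.smul_def, hC] using h'
  | succ k ih =>
    obtain ⟨p, hp, hp'⟩ := ih hB
    choose q hq hq' using fun j => ih (hB.fderiv_apply (stdOrthonormalBasis ℝ E j, 0))
    let A : Fin (Module.finrank ℝ E) → 𝓢(E, ℂ) →L[ℂ] 𝓢(E, ℂ) := fun j =>
      LineDeriv.lineDerivOpCLM ℂ 𝓢(E, ℂ) (stdOrthonormalBasis ℝ E j)
    refine ⟨p + ∑ j, (q j + p.comp (A j).toLinearMap), ?_, fun φ ξ => ?_⟩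
    · have : ⇑(p + ∑ j, (q j + p.comp (A j).toLinearMap))
          = fun φ => p φ + ∑ j, (q j φ + p (A j φ)) := by
        ext φ
        simp [add_apply, sum_apply]
      rw [this]
      exact hp.add (continuous_finsetSum _ fun j _ => (hq j).add (hp.comp (A j).continuous))
    · have hsum : ‖ξ‖ ≤ ∑ j, |inner ℝ (stdOrthonormalBasis ℝ E j) ξ| := by
        conv_lhs => rw [← (stdOrthonormalBasis ℝ E).sum_repr' ξ]
        refine (norm_sum_le _ _).trans (le_of_eq ?_)
        simp [norm_smul]
      have hj : ∀ j, (1 + ‖ξ‖) ^ k * (|inner ℝ (stdOrthonormalBasis ℝ E j) ξ| *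
          ‖oscIntegral B φ ξ‖) ≤ (q j φ + p (A j φ)) * (1 + ‖ξ‖) ^ N := by
        intro j
        have h := congrArg norm (inner_mul_oscIntegral hB φ ξ (stdOrthonormalBasis ℝ E j))
        rw [norm_mul, norm_mul, Complex.norm_real, Real.norm_eq_abs, Complex.norm_I, one_mul] at h
        rw [h, add_mul]
        refine (mul_le_mul_of_nonneg_left (norm_add_le _ _) (by positivity)).trans ?_
        rw [mul_add]
        exact add_le_add (hq' j φ ξ) (hp' (A j φ) ξ)
      calc (1 + ‖ξ‖) ^ (k + 1) * ‖oscIntegral B φ ξ‖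
          = (1 + ‖ξ‖) ^ k * ‖oscIntegral B φ ξ‖
            + (1 + ‖ξ‖) ^ k * (‖ξ‖ * ‖oscIntegral B φ ξ‖) := by ring
        _ ≤ (1 + ‖ξ‖) ^ k * ‖oscIntegral B φ ξ‖
            + (1 + ‖ξ‖) ^ k * ((∑ j, |inner ℝ (stdOrthonormalBasis ℝ E j) ξ|)
              * ‖oscIntegral B φ ξ‖) := by gcongr
        _ = (1 + ‖ξ‖) ^ k * ‖oscIntegral B φ ξ‖
            + ∑ j, (1 + ‖ξ‖) ^ k * (|inner ℝ (stdOrthonormalBasis ℝ E j) ξ|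
              * ‖oscIntegral B φ ξ‖) := by rw [Finset.sum_mul, Finset.mul_sum]
        _ ≤ p φ * (1 + ‖ξ‖) ^ N + ∑ j, (q j φ + p (A j φ)) * (1 + ‖ξ‖) ^ N :=
            add_le_add (hp' φ ξ) (Finset.sum_le_sum fun j _ => hj j)
        _ = _ := by
            rw [← Finset.sum_mul, ← add_mul]
            simp [add_apply, sum_apply]

theorem exists_seminorm_pow_mul_norm_iteratedFDeriv_oscIntegral_le (l k : ℕ)
    (hB : IsAmplitude N B) :
    ∃ p : Seminorm ℂ 𝓢(E, ℂ), Continuous p ∧ ∀ φ ξ,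
      (1 + ‖ξ‖) ^ k * ‖iteratedFDeriv ℝ l (oscIntegral B φ) ξ‖ ≤ p φ := by
  induction l generalizing B with
  | zero =>
    obtain ⟨p, hp, h⟩ := exists_seminorm_pow_mul_norm_oscIntegral_le (k + N) hB
    refine ⟨p, hp, fun φ ξ => ?_⟩
    have := h φ ξ
    rw [norm_iteratedFDeriv_zero]
    refine le_of_mul_le_mul_right (a := (1 + ‖ξ‖) ^ N) ?_ (by positivity)
    calc _ = (1 + ‖ξ‖) ^ (k + N) * ‖oscIntegral B φ ξ‖ := by ring
      _ ≤ _ := this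
  | succ l ih =>
    obtain ⟨p, hp, hp'⟩ := ih hB
    choose q hq hq' using fun j => ih (hB.fderiv_apply (0, stdOrthonormalBasis ℝ E j))
    let A : Fin (Module.finrank ℝ E) → 𝓢(E, ℂ) →L[ℂ] 𝓢(E, ℂ) := fun j =>
      mulInnerCLM (stdOrthonormalBasis ℝ E j)
    refine ⟨∑ j, (q j + p.comp (A j).toLinearMap), ?_, fun φ ξ => ?_⟩
    · have : ⇑(∑ j, (q j + p.comp (A j).toLinearMap))
          = fun φ => ∑ j, (q j φ + p (A j φ)) := by
        ext φ
        simp [add_apply, sum_apply]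
      rw [this]
      exact continuous_finsetSum _ fun j _ => (hq j).add (hp.comp (A j).continuous)
    · have hj : ∀ j, (1 + ‖ξ‖) ^ k * ‖iteratedFDeriv ℝ l
          (fun η => fderiv ℝ (oscIntegral B φ) η (stdOrthonormalBasis ℝ E j)) ξ‖
            ≤ q j φ + p (A j φ) := by
        intro j
        simp_rw [fderiv_oscIntegral_apply hB]
        have c1 := (contDiff_oscIntegral (hB.fderiv_apply (0, stdOrthonormalBasis ℝ E j)) φ).of_le
          (mod_cast le_top : (l : WithTop ℕ∞) ≤ ∞)
        have c2 := (contDiff_oscIntegral hB (A j φ)).of_le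
          (mod_cast le_top : (l : WithTop ℕ∞) ≤ ∞)
        have c3 : ContDiff ℝ l (Complex.I • oscIntegral B (A j φ)) := c2.const_smul Complex.I
        have e : (fun η => oscIntegral (fun p => fderiv ℝ B p (0, stdOrthonormalBasis ℝ E j)) φ η
            + Complex.I * oscIntegral B (mulInnerCLM (stdOrthonormalBasis ℝ E j) φ) η)
            = oscIntegral (fun p => fderiv ℝ B p (0, stdOrthonormalBasis ℝ E j)) φ
              + Complex.I • oscIntegral B (A j φ) := rfl
        rw [e, iteratedFDeriv_add_apply c1.contDiffAt c3.contDiffAt,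
          iteratedFDeriv_const_smul_apply c2.contDiffAt]
        refine (mul_le_mul_of_nonneg_left (norm_add_le _ _) (by positivity)).trans ?_
        rw [mul_add, norm_smul, Complex.norm_I, one_mul]
        exact add_le_add (hq' j φ ξ) (hp' (A j φ) ξ)
      calc (1 + ‖ξ‖) ^ k * ‖iteratedFDeriv ℝ (l + 1) (oscIntegral B φ) ξ‖
        _ ≤ (1 + ‖ξ‖) ^ k * ∑ j, ‖iteratedFDeriv ℝ l
            (fun η => fderiv ℝ (oscIntegral B φ) η (stdOrthonormalBasis ℝ E j)) ξ‖ := by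
            gcongr
            exact norm_iteratedFDeriv_succ_le_sum (contDiff_oscIntegral hB φ) l ξ
        _ ≤ ∑ j, (q j φ + p (A j φ)) := by
            rw [Finset.mul_sum]
            exact Finset.sum_le_sum fun j _ => hj j
        _ = _ := by simp [add_apply, sum_apply]

/-- The map `φ ↦ ∫ e^{i x·ξ} B(x, ξ) φ(x) dx` as a continuous map of the Schwartz space. -/
noncomputable def oscCLM (hB : IsAmplitude N B) : 𝓢(E, ℂ) →L[ℂ] 𝓢(E, ℂ) :=
  SchwartzMap.mkCLM (oscIntegral B) (oscIntegral_add hB) (fun a φ ξ => oscIntegral_smul a φ ξ)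
    (contDiff_oscIntegral hB) fun ⟨k, l⟩ => by
      obtain ⟨p, hp, h⟩ := exists_seminorm_pow_mul_norm_iteratedFDeriv_oscIntegral_le l k hB
      obtain ⟨s, C, -, hC⟩ := Seminorm.bound_of_continuous (schwartz_withSeminorms ℂ E ℂ) p hp
      refine ⟨s, C, C.2, fun φ ξ => ?_⟩
      calc ‖ξ‖ ^ k * ‖iteratedFDeriv ℝ l (oscIntegral B φ) ξ‖
          ≤ (1 + ‖ξ‖) ^ k * ‖iteratedFDeriv ℝ l (oscIntegral B φ) ξ‖ := by gcongr; simp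
        _ ≤ p φ := h φ ξ
        _ ≤ _ := hC φ

@[simp]
theorem oscCLM_apply (hB : IsAmplitude N B) (φ : 𝓢(E, ℂ)) (ξ : E) :
    oscCLM hB φ ξ = oscIntegral B φ ξ := rfl

end Continuity

end Oscillatory

end SupportRule

/-! ### Supports of tempered distributions -/

namespace SupportRule

section Support

open scoped Manifold

variable {E : Type} [NormedAddCommGroup E] [NormedSpace ℝ E] [FiniteDimensional ℝ E]

/-- A partition of unity on `tsupport g` reduces the claim to test functions supported in a single
open set on which `v` vanishes. -/
theorem apply_eq_zero_of_hasCompactSupport (v : 𝓢'(E, ℂ)) (g : 𝓢(E, ℂ)) (hg : HasCompactSupport g)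
    (hgv : tsupport g ⊆ (Distribution.dsupport v)ᶜ) : v g = 0 := by
  have hU : ∀ x, ∃ U : Set E, x ∈ tsupport g →
      Distribution.IsVanishingOn v U ∧ IsOpen U ∧ x ∈ U := by
    intro x
    by_cases hx : x ∈ tsupport g
    · obtain ⟨U, hU⟩ := (Distribution.notMem_dsupport_iff x).1 (hgv hx)
      exact ⟨U, fun _ => hU⟩
    · exact ⟨∅, fun h => absurd h hx⟩
  choose U hU using hU
  obtain ⟨t, ht, hcov⟩ := hg.isCompact.elim_nhds_subcover U
    fun x hx => (hU x hx).2.1.mem_nhds (hU x hx).2.2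
  obtain ⟨ρ, hρ⟩ := SmoothPartitionOfUnity.exists_isSubordinate 𝓘(ℝ, E) (isClosed_tsupport g)
    (fun i : t => U i) (fun i => (hU i (ht i i.2)).2.1) (by simpa [Set.iUnion_subtype] using hcov)
  have hsm : ∀ i, ContDiff ℝ ∞ (fun x => ((ρ i x : ℝ) : ℂ) * g x) := fun i =>
    (Complex.ofRealCLM.contDiff.comp (ρ i).contMDiff.contDiff).mul (g.smooth ⊤)
  have hcs : ∀ i, HasCompactSupport (fun x => ((ρ i x : ℝ) : ℂ) * g x) := fun i => hg.mul_left
  have hsum : g = ∑ i, (hcs i).toSchwartzMap (hsm i) := by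
    ext x
    rw [sum_apply]
    change g x = ∑ i, ((ρ i x : ℝ) : ℂ) * g x
    rw [← Finset.sum_mul]
    by_cases hx : x ∈ tsupport g
    · have := ρ.sum_eq_one hx
      rw [finsum_eq_sum_of_fintype] at this
      rw [← Complex.ofReal_sum, this, Complex.ofReal_one, one_mul]
    · simp [image_eq_zero_of_notMem_tsupport hx]
  rw [hsum, map_sum]
  refine Finset.sum_eq_zero fun i _ => (hU i (ht i i.2)).1 _ ?_
  refine subset_trans ?_ (hρ i)
  exact (tsupport_mul_subset_left (f := fun x => ((ρ i x : ℝ) : ℂ))).trans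
    (tsupport_comp_subset Complex.ofReal_zero (ρ i))

/-- Smooth truncations `χ(x / R) g` of a Schwartz function converge to it: the difference lives
where `|x| ≥ R`, and there each weight gains a factor `|x| / R ≥ 1`. -/
theorem exists_tendsto_hasCompactSupport (g : 𝓢(E, ℂ)) : ∃ G : ℕ → 𝓢(E, ℂ),
    (∀ j, HasCompactSupport (G j) ∧ tsupport (G j) ⊆ tsupport g) ∧
      Filter.Tendsto G Filter.atTop (𝓝 g) := by
  let χ : ContDiffBump (0 : E) := ⟨1, 2, one_pos, one_lt_two⟩
  have hXs : ContDiff ℝ ∞ (fun x => ((χ x : ℝ) : ℂ)) := Complex.ofRealCLM.contDiff.comp χ.contDiff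
  have hXc : HasCompactSupport (fun x => ((χ x : ℝ) : ℂ)) :=
    χ.hasCompactSupport.comp_left Complex.ofReal_zero
  let X : 𝓢(E, ℂ) := hXc.toSchwartzMap hXs
  have hX1 : ∀ x : E, ‖x‖ ≤ 1 → X x = 1 := fun x hx => by
    change ((χ x : ℝ) : ℂ) = 1
    rw [χ.one_of_mem_closedBall (by simpa using hx), Complex.ofReal_one]
  let L : ℕ → E →L[ℝ] E := fun j => ((j + 1 : ℝ)⁻¹) • ContinuousLinearMap.id ℝ E
  have hLx : ∀ j x, L j x = (j + 1 : ℝ)⁻¹ • x := fun j x => rfl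
  have hpos : ∀ j : ℕ, (1 : ℝ) ≤ j + 1 := fun j => by simp
  have hLn : ∀ j, ‖L j‖ ≤ 1 := by
    intro j
    refine ContinuousLinearMap.opNorm_le_bound _ zero_le_one fun x => ?_
    rw [hLx, norm_smul, norm_inv, Real.norm_of_nonneg (by positivity)]
    gcongr
    exact inv_le_one_of_one_le₀ (hpos j)
  have hsm : ∀ j, ContDiff ℝ ∞ (X ∘ L j) := fun j => (X.smooth ⊤).comp (L j).contDiff
  have hcs : ∀ j, HasCompactSupport (fun x => X (L j x) * g x) := by
    intro j
    refine HasCompactSupport.mul_right ?_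
    have hj : ((j + 1 : ℝ)⁻¹) ≠ 0 := by have := hpos j; positivity
    exact hXc.comp_smul hj
  refine ⟨fun j => (hcs j).toSchwartzMap ((hsm j).mul (g.smooth ⊤)), fun j => ⟨hcs j,
    tsupport_mul_subset_right⟩, ?_⟩
  rw [(schwartz_withSeminorms ℂ E ℂ).tendsto_nhds]
  rintro ⟨k, l⟩ ε hε
  -- Leibniz' rule for `χ(x / R) g - g`, with the weight `|x| ^ (k + 1)` in place of `|x| ^ k`.
  let M : ℝ := (∑ i ∈ Finset.range (l + 1), (l.choose i : ℝ) * SchwartzMap.seminorm ℝ 0 i X *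
    SchwartzMap.seminorm ℝ (k + 1) (l - i) g) + SchwartzMap.seminorm ℝ (k + 1) l g
  have hM : 0 ≤ M := add_nonneg (Finset.sum_nonneg fun i _ => mul_nonneg
    (mul_nonneg (by positivity) (apply_nonneg _ _)) (apply_nonneg _ _)) (apply_nonneg _ _)
  have key : ∀ j : ℕ, SchwartzMap.seminorm ℂ k l
      ((hcs j).toSchwartzMap ((hsm j).mul (g.smooth ⊤)) - g) ≤ M * (j + 1 : ℝ)⁻¹ := by
    intro j
    refine SchwartzMap.seminorm_le_bound _ _ _ _ (by positivity) fun x => ?_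
    have hcoe : ⇑((hcs j).toSchwartzMap ((hsm j).mul (g.smooth ⊤)) - g)
        = (fun x => (X ∘ L j) x * g x) - g := rfl
    rw [hcoe]
    have hjp : (0 : ℝ) < j + 1 := by positivity
    rcases lt_or_ge ‖x‖ (j + 1 : ℝ) with hx | hx
    · have hz : (fun x => (X ∘ L j) x * g x) - ⇑g =ᶠ[𝓝 x] fun _ => 0 := by
        filter_upwards [(isOpen_lt continuous_norm continuous_const).mem_nhds hx] with y hy
        have : ‖L j y‖ ≤ 1 := by
          rw [hLx, norm_smul, norm_inv, Real.norm_of_nonneg hjp.le, inv_mul_le_one₀ hjp]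
          exact le_of_lt hy
        simp [hX1 _ this]
      rw [(Filter.EventuallyEq.iteratedFDeriv ℝ hz l).eq_of_nhds]
      simp only [iteratedFDeriv_fun_zero, Pi.zero_apply, norm_zero, mul_zero]
      positivity
    · have h1 : ‖x‖ ^ k ≤ (j + 1 : ℝ)⁻¹ * ‖x‖ ^ (k + 1) := by
        rw [inv_mul_eq_div, le_div_iff₀ hjp, pow_succ]
        gcongr
      have hDX : ∀ i, ‖iteratedFDeriv ℝ i (X ∘ L j) x‖ ≤ SchwartzMap.seminorm ℝ 0 i X := by
        intro i
        rw [(L j).iteratedFDeriv_comp_right (n := ∞) (X.smooth ⊤) x (mod_cast le_top)]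
        refine (ContinuousMultilinearMap.norm_compContinuousLinearMap_le _ _).trans ?_
        refine (mul_le_of_le_one_right (norm_nonneg _) (Finset.prod_le_one
          (fun _ _ => norm_nonneg _) fun _ _ => hLn j)).trans ?_
        exact X.norm_iteratedFDeriv_le_seminorm ℝ i _
      have h2 : ‖x‖ ^ (k + 1) * ‖iteratedFDeriv ℝ l ((fun x => (X ∘ L j) x * g x) - ⇑g) x‖ ≤ M := by
        have c1 : ContDiff ℝ l (fun x => (X ∘ L j) x * g x) :=
          ((hsm j).mul (g.smooth ⊤)).of_le (mod_cast le_top)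
        rw [iteratedFDeriv_sub_apply c1.contDiffAt (g.smooth l).contDiffAt]
        refine (mul_le_mul_of_nonneg_left (norm_sub_le _ _) (by positivity)).trans ?_
        rw [mul_add]
        refine add_le_add ?_ (g.le_seminorm ℝ (k + 1) l x)
        refine (mul_le_mul_of_nonneg_left (norm_iteratedFDeriv_mul_le (N := ∞) (hsm j)
          (g.smooth ⊤) x (mod_cast le_top)) (by positivity)).trans ?_
        rw [Finset.mul_sum]
        refine Finset.sum_le_sum fun i _ => ?_
        calc ‖x‖ ^ (k + 1) * ((l.choose i : ℝ) * ‖iteratedFDeriv ℝ i (X ∘ L j) x‖ *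
              ‖iteratedFDeriv ℝ (l - i) g x‖)
            = (l.choose i : ℝ) * ‖iteratedFDeriv ℝ i (X ∘ L j) x‖ *
              (‖x‖ ^ (k + 1) * ‖iteratedFDeriv ℝ (l - i) g x‖) := by ring
          _ ≤ _ := mul_le_mul (mul_le_mul_of_nonneg_left (hDX i) (by positivity))
              (g.le_seminorm ℝ (k + 1) (l - i) x) (by positivity)
              (mul_nonneg (by positivity) (apply_nonneg _ _))
      calc _ ≤ ((j + 1 : ℝ)⁻¹ * ‖x‖ ^ (k + 1)) *
            ‖iteratedFDeriv ℝ l ((fun x => (X ∘ L j) x * g x) - ⇑g) x‖ := by gcongr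
        _ = (j + 1 : ℝ)⁻¹ * (‖x‖ ^ (k + 1) *
            ‖iteratedFDeriv ℝ l ((fun x => (X ∘ L j) x * g x) - ⇑g) x‖) := by ring
        _ ≤ (j + 1 : ℝ)⁻¹ * M := by gcongr
        _ = _ := mul_comm _ _
  have hlim : Filter.Tendsto (fun j : ℕ => M * (j + 1 : ℝ)⁻¹) Filter.atTop (𝓝 0) := by
    simpa [one_div] using (tendsto_one_div_add_atTop_nhds_zero_nat (𝕜 := ℝ)).const_mul M
  filter_upwards [hlim.eventually (gt_mem_nhds hε)] with j hj
  exact (key j).trans_lt hj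

/-- A tempered distribution vanishes on the whole complement of its support. -/
theorem apply_eq_zero_of_tsupport_subset (v : 𝓢'(E, ℂ)) (g : 𝓢(E, ℂ))
    (hgv : tsupport g ⊆ (Distribution.dsupport v)ᶜ) : v g = 0 := by
  obtain ⟨G, hG, hlim⟩ := exists_tendsto_hasCompactSupport g
  have h0 : ∀ j, v (G j) = 0 := fun j =>
    apply_eq_zero_of_hasCompactSupport v (G j) (hG j).1 ((hG j).2.trans hgv)
  have h1 : Filter.Tendsto (fun j => v (G j)) Filter.atTop (𝓝 (v g)) :=
    ((map_continuous v).tendsto g).comp hlim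
  simp_rw [h0] at h1
  exact tendsto_nhds_unique h1 tendsto_const_nhds

theorem apply_eq_of_eventually_eq (v : 𝓢'(E, ℂ)) {f g : 𝓢(E, ℂ)}
    (h : ∀ᶠ ξ in 𝓝ˢ (Distribution.dsupport v), f ξ = g ξ) : v f = v g := by
  rw [← sub_eq_zero, ← map_sub]
  refine apply_eq_zero_of_tsupport_subset v _ fun x hx hxv => ?_
  rw [Filter.eventually_iff, mem_nhdsSet_iff_forall] at h
  refine notMem_tsupport_iff_eventuallyEq.2 ?_ hx
  filter_upwards [h x hxv] with y hy
  simpa [sub_eq_zero] using hy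

variable [MeasurableSpace E] [BorelSpace E] {μ : Measure E} [μ.IsAddHaarMeasure]

/-- The fundamental lemma of the calculus of variations on an open set, with complex-valued
Schwartz test functions. -/
theorem eqOn_zero_of_integral_eq_zero {f : E → ℂ} (hf : Continuous f) {U : Set E} (hU : IsOpen U)
    (h : ∀ g : 𝓢(E, ℂ), HasCompactSupport g → tsupport g ⊆ U → ∫ x, g x * f x ∂μ = 0) :
    ∀ x ∈ U, f x = 0 := by
  have hae := hU.ae_eq_zero_of_integral_contDiff_smul_eq_zero (μ := μ)
    (hf.locallyIntegrable.locallyIntegrableOn U) fun g hg hgc hgU => by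
      have hs : ContDiff ℝ ∞ (fun x => ((g x : ℝ) : ℂ)) := Complex.ofRealCLM.contDiff.comp hg
      have hc : HasCompactSupport (fun x => ((g x : ℝ) : ℂ)) := hgc.comp_left Complex.ofReal_zero
      simpa using h (hc.toSchwartzMap hs) hc
        ((tsupport_comp_subset Complex.ofReal_zero g).trans hgU)
  exact Measure.eqOn_open_of_ae_eq ((ae_restrict_iff' hU.measurableSet).2 hae) hU
    hf.continuousOn continuousOn_const

end Support

/-! ### Density of the Schwartz functions -/

section Density

variable {E : Type} [NormedAddCommGroup E] [NormedSpace ℝ E]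

/-- The continuous functionals on `𝓢'`, for pointwise convergence, are the evaluations at Schwartz
functions. -/
theorem exists_eq_apply (Λ : 𝓢'(E, ℂ) →L[ℂ] ℂ) : ∃ ψ : 𝓢(E, ℂ), ∀ v, Λ v = v ψ := by
  obtain ⟨ψ, hψ⟩ := LinearMap.dualEmbedding_surjective (topDualPairing ℂ 𝓢(E, ℂ))
    (Λ.comp (PointwiseConvergenceCLM.equivWeakDual ℂ 𝓢(E, ℂ)).symm.toContinuousLinearMap)
  refine ⟨ψ, fun v => ?_⟩
  have := congrArg (fun L => L (PointwiseConvergenceCLM.equivWeakDual ℂ 𝓢(E, ℂ) v)) hψ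
  exact this.symm

end Density

end SupportRule

/-! ### The Fourier transform -/

namespace SupportRule

section Fourier

variable {n : ℕ}

/-- The inverse of the Fourier transform `fourierS` on the Schwartz space. -/
noncomputable def fourierSInv (n : ℕ) :
    𝓢(EuclideanSpace ℝ (Fin n), ℂ) →L[ℂ] 𝓢(EuclideanSpace ℝ (Fin n), ℂ) :=
  (FourierTransform.fourierInvCLM ℂ 𝓢(EuclideanSpace ℝ (Fin n), ℂ)).comp
    (SchwartzMap.compCLMOfContinuousLinearEquiv ℂ (dilation n).symm)

theorem fourierS_fourierSInv (u : 𝓢(EuclideanSpace ℝ (Fin n), ℂ)) :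
    fourierS n (fourierSInv n u) = u := by
  ext x
  simp [fourierS, fourierSInv]

theorem integral_fourierS_mul (f g : 𝓢(EuclideanSpace ℝ (Fin n), ℂ)) :
    ∫ ξ, fourierS n f ξ * g ξ = ∫ x, f x * fourierS n g x := by
  simp_rw [fourierS_apply, ← integral_const_mul, ← integral_mul_const]
  rw [integral_integral_swap]
  · congr 1; ext x; congr 1; ext ξ
    rw [real_inner_comm]
    ring
  · refine (g.integrable.norm.mul_prod f.integrable.norm).mono'
      (by fun_prop : Continuous _).aestronglyMeasurable (.of_forall fun p => ?_)
    rw [Function.uncurry_apply_pair, norm_mul, norm_mul, neg_mul, Complex.norm_exp]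
    simp [mul_comm]

theorem fourierD_apply (v : 𝓢'(EuclideanSpace ℝ (Fin n), ℂ))
    (φ : 𝓢(EuclideanSpace ℝ (Fin n), ℂ)) : fourierD n v φ = v (fourierS n φ) := rfl

theorem fourierD_coe_apply (u φ : 𝓢(EuclideanSpace ℝ (Fin n), ℂ)) :
    fourierD n (u : 𝓢'(EuclideanSpace ℝ (Fin n), ℂ)) φ = ∫ ξ, φ ξ * fourierS n u ξ := by
  rw [fourierD_apply, SchwartzMap.coe_apply]
  exact integral_fourierS_mul φ u

/-- The distributional support of `û` contains the points where the function `û` is not zero. -/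
theorem fourierS_eq_zero_of_notMem_dsupport (u : 𝓢(EuclideanSpace ℝ (Fin n), ℂ))
    {ξ : EuclideanSpace ℝ (Fin n)} (hξ : ξ ∉ Distribution.dsupport
      (fourierD n (u : 𝓢'(EuclideanSpace ℝ (Fin n), ℂ)))) : fourierS n u ξ = 0 := by
  obtain ⟨U, hUv, hUo, hU⟩ := (Distribution.notMem_dsupport_iff ξ).1 hξ
  refine eqOn_zero_of_integral_eq_zero (μ := volume) (fourierS n u).continuous hUo
    (fun g _ hg => ?_) ξ hU
  rw [← fourierD_coe_apply]
  exact hUv g hg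

/-- The Fourier multiplier `χ(D)` on tempered distributions. -/
noncomputable def cutoffD (χ : EuclideanSpace ℝ (Fin n) → ℂ) :
    𝓢'(EuclideanSpace ℝ (Fin n), ℂ) →L[ℂ] 𝓢'(EuclideanSpace ℝ (Fin n), ℂ) :=
  PointwiseConvergenceCLM.precomp ℂ
    ((fourierS n).comp ((SchwartzMap.smulLeftCLM ℂ χ).comp (fourierSInv n)))

theorem cutoffD_apply (χ : EuclideanSpace ℝ (Fin n) → ℂ)
    (v : 𝓢'(EuclideanSpace ℝ (Fin n), ℂ)) (φ : 𝓢(EuclideanSpace ℝ (Fin n), ℂ)) :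
    cutoffD χ v φ = fourierD n v (SchwartzMap.smulLeftCLM ℂ χ (fourierSInv n φ)) := rfl

theorem cutoffD_eq_self {χ : EuclideanSpace ℝ (Fin n) → ℂ} (hχ : χ.HasTemperateGrowth)
    {v : 𝓢'(EuclideanSpace ℝ (Fin n), ℂ)}
    (h : ∀ᶠ ξ in 𝓝ˢ (Distribution.dsupport (fourierD n v)), χ ξ = 1) : cutoffD χ v = v := by
  ext φ
  rw [cutoffD_apply]
  trans fourierD n v (fourierSInv n φ)
  · refine apply_eq_of_eventually_eq _ (h.mono fun ξ hξ => ?_)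
    rw [SchwartzMap.smulLeftCLM_apply_apply hχ, hξ, one_smul]
  · rw [fourierD_apply, fourierS_fourierSInv]

/-- On Schwartz functions `χ(D)u` is the function with Fourier transform `χ û`. -/
theorem cutoffD_coe {χ : EuclideanSpace ℝ (Fin n) → ℂ} (hχ : χ.HasTemperateGrowth)
    (u : 𝓢(EuclideanSpace ℝ (Fin n), ℂ)) :
    cutoffD χ (u : 𝓢'(EuclideanSpace ℝ (Fin n), ℂ)) =
      ((fourierSInv n (SchwartzMap.smulLeftCLM ℂ χ (fourierS n u)) :
        𝓢(EuclideanSpace ℝ (Fin n), ℂ)) : 𝓢'(EuclideanSpace ℝ (Fin n), ℂ)) := by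
  ext φ
  set w := fourierSInv n (SchwartzMap.smulLeftCLM ℂ χ (fourierS n u)) with hw
  have h : (w : 𝓢'(EuclideanSpace ℝ (Fin n), ℂ)) φ
      = fourierD n (w : 𝓢'(EuclideanSpace ℝ (Fin n), ℂ)) (fourierSInv n φ) := by
    rw [fourierD_apply, fourierS_fourierSInv]
  rw [h, cutoffD_apply, fourierD_coe_apply, fourierD_coe_apply, hw, fourierS_fourierSInv]
  congr 1
  ext ξ
  rw [SchwartzMap.smulLeftCLM_apply_apply hχ, SchwartzMap.smulLeftCLM_apply_apply hχ]
  simp only [smul_eq_mul]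
  ring

end Fourier

/-! ### Operators on tempered distributions -/

section Operators

variable {n N : ℕ}

/-- The operator on `𝓢'` with amplitude `B`, defined by duality:
`⟨B(x, D)v, φ⟩ = (2π)⁻ⁿ ⟨v̂, ∫ e^{i x·ξ} B(x, ξ) φ(x) dx⟩`. -/
noncomputable def pdo {B : EuclideanSpace ℝ (Fin n) × EuclideanSpace ℝ (Fin n) → ℂ}
    (hB : IsAmplitude N B) :
    𝓢'(EuclideanSpace ℝ (Fin n), ℂ) →L[ℂ] 𝓢'(EuclideanSpace ℝ (Fin n), ℂ) :=
  PointwiseConvergenceCLM.precomp ℂ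
    (((2 * Real.pi : ℂ) ^ n)⁻¹ • (fourierS n).comp (oscCLM hB))

theorem pdo_apply {B : EuclideanSpace ℝ (Fin n) × EuclideanSpace ℝ (Fin n) → ℂ}
    (hB : IsAmplitude N B) (v : 𝓢'(EuclideanSpace ℝ (Fin n), ℂ))
    (φ : 𝓢(EuclideanSpace ℝ (Fin n), ℂ)) :
    pdo hB v φ = ((2 * Real.pi : ℂ) ^ n)⁻¹ * fourierD n v (oscCLM hB φ) := by
  change v ((((2 * Real.pi : ℂ) ^ n)⁻¹ • (fourierS n).comp (oscCLM hB)) φ) = _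
  rw [smul_apply, map_smul]
  rfl

variable {b : EuclideanSpace ℝ (Fin n) → EuclideanSpace ℝ (Fin n) → ℂ}

theorem integrable_prod_oscIntegrand
    (hB : IsAmplitude N (fun p : EuclideanSpace ℝ (Fin n) × EuclideanSpace ℝ (Fin n) => b p.1 p.2))
    (φ h : 𝓢(EuclideanSpace ℝ (Fin n), ℂ)) :
    Integrable (fun p : EuclideanSpace ℝ (Fin n) × EuclideanSpace ℝ (Fin n) =>
      Complex.exp (Complex.I * (inner ℝ p.1 p.2 : ℝ)) * b p.1 p.2 * φ p.1 * h p.2)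
      (volume.prod volume) := by
  obtain ⟨C, hC, hb⟩ := hB.norm_le
  have hc := hB.contDiff.continuous
  have hi : Integrable (fun ξ : EuclideanSpace ℝ (Fin n) => C * (1 + ‖ξ‖) ^ N * ‖h ξ‖) := by
    have e : (fun ξ : EuclideanSpace ℝ (Fin n) => C * (1 + ‖ξ‖) ^ N * ‖h ξ‖) = fun ξ =>
        C * ∑ i ∈ Finset.range (N + 1), (N.choose i : ℝ) * (‖ξ‖ ^ i * ‖h ξ‖) := by
      ext ξ
      rw [add_comm, add_pow, mul_assoc, Finset.sum_mul]
      congr 1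
      refine Finset.sum_congr rfl fun i _ => ?_
      rw [one_pow]
      ring
    rw [e]
    exact (integrable_finsetSum _ fun i _ =>
      (h.integrable_pow_mul volume i).const_mul _).const_mul _
  refine (φ.integrable.norm.mul_prod hi).mono'
    (by fun_prop : Continuous _).aestronglyMeasurable (.of_forall fun p => ?_)
  rw [norm_mul, norm_mul, norm_mul, Complex.norm_exp_I_mul_ofReal, one_mul, mul_comm ‖b p.1 p.2‖,
    mul_assoc]
  gcongr
  exact hb p

/-- Fubini's theorem: on Schwartz functions the operator defined by duality is given by the integral
formula. -/
theorem isExtension_pdo (hB : IsAmplitude N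
    (fun p : EuclideanSpace ℝ (Fin n) × EuclideanSpace ℝ (Fin n) => b p.1 p.2)) :
    IsExtension b (pdo hB) := by
  intro u φ
  have hi := integrable_prod_oscIntegrand hB φ (fourierS n u)
  have e : (fun x => φ x * opS b u x) = fun x => ((2 * Real.pi : ℂ) ^ n)⁻¹ *
      ∫ ξ, Complex.exp (Complex.I * (inner ℝ x ξ : ℝ)) * b x ξ * φ x * fourierS n u ξ := by
    ext x
    rw [opS, mul_left_comm, ← integral_const_mul]
    congr 2
    ext ξ
    ring
  rw [e]
  refine ⟨hi.integral_prod_left.const_mul _, ?_⟩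
  rw [pdo_apply, fourierD_coe_apply, integral_const_mul, integral_integral_swap hi]
  congr 2
  ext ξ
  rw [oscCLM_apply, oscIntegral, ← integral_mul_const]

/-- The Schwartz functions are dense in `𝓢'`, so that an extension of `b(x, D)` is unique. -/
theorem IsExtension.unique
    {T T' : 𝓢'(EuclideanSpace ℝ (Fin n), ℂ) →L[ℂ] 𝓢'(EuclideanSpace ℝ (Fin n), ℂ)}
    (hT : IsExtension b T) (hT' : IsExtension b T') : T = T' := by
  ext v φ
  obtain ⟨ψ, hψ⟩ := exists_eq_apply
    ((PointwiseConvergenceCLM.evalCLM (RingHom.id ℂ) ℂ φ).comp (T - T'))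
  have hψ' : ∀ v, T v φ - T' v φ = v ψ := hψ
  have h0 : ψ = 0 := by
    ext x
    refine eqOn_zero_of_integral_eq_zero (μ := volume) ψ.continuous isOpen_univ
      (fun u _ _ => ?_) x (Set.mem_univ x)
    have h := hψ' (u : 𝓢'(EuclideanSpace ℝ (Fin n), ℂ))
    rw [(hT u φ).2, (hT' u φ).2, sub_self, SchwartzMap.coe_apply] at h
    rw [h]
    congr 1
    ext y
    exact mul_comm _ _
  rw [← sub_eq_zero, hψ' v, h0, map_zero]

end Operators

/-! ### The support rule -/

section Rule

variable {n N : ℕ} {b : EuclideanSpace ℝ (Fin n) → EuclideanSpace ℝ (Fin n) → ℂ}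
  {χ : EuclideanSpace ℝ (Fin n) → ℂ}

/-- Formally `∫ e^{i x·η} b(x, η) φ̂(x) dx = ⟨b̂(·, η), φ(· + η)⟩`. Testing in `η` against `h` turns
this into the pairing of `b̂` with `φ(ξ + η) h(η)`. -/
theorem partialFourier_eq_integral
    (hB : IsAmplitude N
      (fun p : EuclideanSpace ℝ (Fin n) × EuclideanSpace ℝ (Fin n) => b p.1 p.2 * χ p.2))
    (φ h : 𝓢(EuclideanSpace ℝ (Fin n), ℂ)) (hχ : ∀ η, h η ≠ 0 → χ η = 1)
    (Φ : 𝓢(EuclideanSpace ℝ (Fin n) × EuclideanSpace ℝ (Fin n), ℂ))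
    (hΦ : ∀ ξ η, Φ (ξ, η) = φ (ξ + η) * h η) :
    partialFourier b Φ = ∫ η, h η * oscIntegral (fun p => b p.1 p.2 * χ p.2) (fourierS n φ) η := by
  have inner_eq : ∀ x η : EuclideanSpace ℝ (Fin n),
      ∫ ξ, Complex.exp (-Complex.I * (inner ℝ x ξ : ℝ)) * Φ (ξ, η) =
        Complex.exp (Complex.I * (inner ℝ x η : ℝ)) * fourierS n φ x * h η := by
    intro x η
    rw [← integral_sub_right_eq_self _ η, fourierS_apply, ← integral_const_mul,
      ← integral_mul_const]
    congr 1
    ext ξ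
    rw [hΦ, sub_add_cancel, inner_sub_right, real_inner_comm ξ x, ← mul_assoc, ← mul_assoc,
      ← Complex.exp_add]
    congr 3
    push_cast
    ring
  have hp : ∀ p : EuclideanSpace ℝ (Fin n) × EuclideanSpace ℝ (Fin n),
      b p.1 p.2 * ∫ ξ, Complex.exp (-Complex.I * (inner ℝ p.1 ξ : ℝ)) * Φ (ξ, p.2) =
        Complex.exp (Complex.I * (inner ℝ p.1 p.2 : ℝ)) * (b p.1 p.2 * χ p.2) *
          fourierS n φ p.1 * h p.2 := by
    intro p
    rw [inner_eq]
    by_cases hz : h p.2 = 0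
    · simp [hz]
    · rw [hχ _ hz]
      ring
  rw [partialFourier]
  simp_rw [hp]
  rw [Measure.volume_eq_prod, integral_prod_symm _
    (integrable_prod_oscIntegrand (b := fun x ξ => b x ξ * χ ξ) hB (fourierS n φ) h)]
  congr 1
  ext η
  rw [oscIntegral, ← integral_const_mul]
  congr 1
  ext x
  ring

/-- If `b̂` vanishes at all points `(ζ - η, η)` with `ζ ∈ U` and `η ∈ V`, then the transpose maps a
transform `φ̂` with `φ` supported in `U` to a function that vanishes on `V`. -/
theorem oscIntegral_fourierS_eq_zero
    (hB : IsAmplitude N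
      (fun p : EuclideanSpace ℝ (Fin n) × EuclideanSpace ℝ (Fin n) => b p.1 p.2 * χ p.2))
    {U V : Set (EuclideanSpace ℝ (Fin n))}
    {W : Set (EuclideanSpace ℝ (Fin n) × EuclideanSpace ℝ (Fin n))} (hV : IsOpen V)
    (hχ : ∀ η ∈ V, χ η = 1) (hW : Distribution.IsVanishingOn (partialFourier b) W)
    (hUVW : ∀ ζ ∈ U, ∀ η ∈ V, (ζ - η, η) ∈ W) {φ : 𝓢(EuclideanSpace ℝ (Fin n), ℂ)}
    (hφc : HasCompactSupport φ) (hφ : tsupport φ ⊆ U) :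
    ∀ η ∈ V, oscIntegral (fun p => b p.1 p.2 * χ p.2) (fourierS n φ) η = 0 := by
  refine eqOn_zero_of_integral_eq_zero (μ := volume) (oscCLM hB (fourierS n φ)).continuous hV
    fun h hhc hh => ?_
  let F : EuclideanSpace ℝ (Fin n) × EuclideanSpace ℝ (Fin n) → ℂ :=
    fun p => φ (p.1 + p.2) * h p.2
  have hFs : ContDiff ℝ ∞ F :=
    ((φ.smooth ⊤).comp (contDiff_fst.add contDiff_snd)).mul ((h.smooth ⊤).comp contDiff_snd)
  have hsub : Function.support F ⊆ (fun q : EuclideanSpace ℝ (Fin n) × EuclideanSpace ℝ (Fin n) =>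
      (q.1 - q.2, q.2)) '' (tsupport φ ×ˢ tsupport h) := by
    intro p hp
    refine ⟨(p.1 + p.2, p.2), ⟨subset_tsupport _ ?_, subset_tsupport _ ?_⟩, by simp⟩
    · exact left_ne_zero_of_mul hp
    · exact right_ne_zero_of_mul hp
  have hK : IsCompact ((fun q : EuclideanSpace ℝ (Fin n) × EuclideanSpace ℝ (Fin n) =>
      (q.1 - q.2, q.2)) '' (tsupport φ ×ˢ tsupport h)) :=
    (hφc.isCompact.prod hhc.isCompact).image (by fun_prop)
  have hts := closure_minimal hsub hK.isClosed
  have hFc : HasCompactSupport F := hK.of_isClosed_subset (isClosed_tsupport F) hts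
  have hzero : partialFourier b (hFc.toSchwartzMap hFs) = 0 := by
    refine hW _ (hts.trans ?_)
    rintro _ ⟨q, ⟨h1, h2⟩, rfl⟩
    exact hUVW _ (hφ h1) _ (hh h2)
  rw [partialFourier_eq_integral hB φ h
    (fun η hη => hχ η (hh (subset_tsupport _ hη))) _ fun ξ η => rfl] at hzero
  exact hzero

/-- If `ζ` is not of the form `ξ + η` with `(ξ, η) ∈ supp b̂` and `η ∈ supp v̂`, then by compactness
of `supp v̂` there is a single neighbourhood `U` of `ζ` such that the transpose of `(b χ)(x, D)` maps
`φ̂`, for each `φ` supported in `U`, to a function that vanishes near `supp v̂`. -/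
theorem dsupport_fourierD_pdo_subset
    (hB : IsAmplitude N
      (fun p : EuclideanSpace ℝ (Fin n) × EuclideanSpace ℝ (Fin n) => b p.1 p.2 * χ p.2))
    (v : 𝓢'(EuclideanSpace ℝ (Fin n), ℂ))
    (hv : IsCompact (Distribution.dsupport (fourierD n v)))
    (hχ : ∀ᶠ ξ in 𝓝ˢ (Distribution.dsupport (fourierD n v)), χ ξ = 1) :
    Distribution.dsupport (fourierD n (pdo hB v)) ⊆ sumSet b v := by
  intro ζ
  contrapose
  intro hζ
  obtain ⟨O, hO, hKO, hOχ⟩ := mem_nhdsSet_iff_exists.1 hχ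
  have hloc : ∀ η, ∃ U V : Set (EuclideanSpace ℝ (Fin n)),
      η ∈ Distribution.dsupport (fourierD n v) → IsOpen U ∧ ζ ∈ U ∧ IsOpen V ∧ η ∈ V ∧ V ⊆ O ∧
        ∃ W, Distribution.IsVanishingOn (partialFourier b) W ∧
          ∀ ζ' ∈ U, ∀ η' ∈ V, (ζ' - η', η') ∈ W := by
    intro η
    by_cases hη : η ∈ Distribution.dsupport (fourierD n v)
    · have hb : (ζ - η, η) ∉ Distribution.dsupport (partialFourier b) := fun h =>
        hζ ⟨ζ - η, η, h, hη, by simp⟩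
      obtain ⟨W, hWv, hWo, hW⟩ := (Distribution.notMem_dsupport_iff _).1 hb
      have hpre : (fun q : EuclideanSpace ℝ (Fin n) × EuclideanSpace ℝ (Fin n) =>
          (q.1 - q.2, q.2)) ⁻¹' W ∈ 𝓝 (ζ, η) :=
        (hWo.preimage (by fun_prop)).mem_nhds hW
      obtain ⟨U, V, hU, hζU, hV, hηV, hUV⟩ := mem_nhds_prod_iff'.1 hpre
      exact ⟨U, V ∩ O, fun _ => ⟨hU, hζU, hV.inter hO, ⟨hηV, hKO hη⟩, Set.inter_subset_right,
        W, hWv, fun ζ' hζ' η' hη' =>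
          hUV (show (ζ', η') ∈ U ×ˢ V from Set.mk_mem_prod hζ' hη'.1)⟩⟩
    · exact ⟨∅, ∅, fun h => absurd h hη⟩
  choose U V hUV using hloc
  obtain ⟨t, ht, hcov⟩ := hv.elim_nhds_subcover V
    fun η hη => (hUV η hη).2.2.1.mem_nhds (hUV η hη).2.2.2.1
  -- The unit ball only serves to make the supports of the test functions compact.
  refine (Distribution.notMem_dsupport_iff ζ).2 ⟨(⋂ η ∈ t, U η) ∩ Metric.ball ζ 1, ?_, ?_, ?_⟩
  · intro φ hφ
    have hφc : HasCompactSupport φ := (isCompact_closedBall ζ 1).of_isClosed_subset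
      (isClosed_tsupport φ) ((hφ.trans Set.inter_subset_right).trans Metric.ball_subset_closedBall)
    rw [fourierD_apply, pdo_apply]
    have h0 : fourierD n v (oscCLM hB (fourierS n φ)) = fourierD n v 0 := by
      refine apply_eq_of_eventually_eq _ (mem_nhdsSet_iff_exists.2
        ⟨⋃ η ∈ t, V η, isOpen_biUnion fun η hη => (hUV η (ht η hη)).2.2.1, hcov, ?_⟩)
      intro η' hη'
      obtain ⟨η, hη, hηV⟩ := Set.mem_iUnion₂.1 hη'
      obtain ⟨-, -, hVo, -, hVO, W, hW, hUVW⟩ := hUV η (ht η hη)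
      exact oscIntegral_fourierS_eq_zero hB hVo (fun η hη => hOχ (hVO hη)) hW hUVW hφc
        (hφ.trans (Set.inter_subset_left.trans (Set.biInter_subset_of_mem hη))) η' hηV
    rw [h0, map_zero, mul_zero]
  · exact (isOpen_biInter_finset fun η hη => (hUV η (ht η hη)).1).inter Metric.isOpen_ball
  · exact ⟨Set.mem_iInter₂.2 fun η hη => (hUV η (ht η hη)).2.1, Metric.mem_ball_self one_pos⟩

open scoped Manifold in
theorem exists_contDiff_hasCompactSupport_one_nhdsSet {K : Set (EuclideanSpace ℝ (Fin n))}
    (hK : IsCompact K) : ∃ χ : EuclideanSpace ℝ (Fin n) → ℂ,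
      ContDiff ℝ ∞ χ ∧ HasCompactSupport χ ∧ ∀ᶠ ξ in 𝓝ˢ K, χ ξ = 1 := by
  obtain ⟨L, hL, hKL⟩ := exists_compact_superset hK
  obtain ⟨f, h1, h0, -⟩ := exists_contMDiffMap_one_nhds_of_subset_interior
    𝓘(ℝ, EuclideanSpace ℝ (Fin n)) (n := ⊤) hK.isClosed hKL
  refine ⟨fun x => ((f x : ℝ) : ℂ), Complex.ofRealCLM.contDiff.comp f.contMDiff.contDiff,
    HasCompactSupport.intro hL fun x hx => by simp [h0 x hx],
    h1.mono fun x hx => by simp [hx]⟩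

/-- `(b χ)(x, D)u = b(x, D)(χ(D)u)` for a Schwartz function `u`, with `w = χ(D)u`. -/
theorem opS_mul_eq {u w : 𝓢(EuclideanSpace ℝ (Fin n), ℂ)}
    (h : ∀ ξ, fourierS n w ξ = χ ξ * fourierS n u ξ) :
    opS (fun x ξ => b x ξ * χ ξ) u = opS b w := by
  ext x
  simp only [opS, h, mul_assoc]

/-- An extension `T` of `b(x, D)` composed with `χ(D)` extends `(b χ)(x, D)`, and `χ(D)v = v` when
`χ = 1` near the support of `v̂`. -/
theorem IsExtension.pdo_eq {T : 𝓢'(EuclideanSpace ℝ (Fin n), ℂ) →L[ℂ]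
      𝓢'(EuclideanSpace ℝ (Fin n), ℂ)} (hT : IsExtension b T)
    (hB : IsAmplitude N
      (fun p : EuclideanSpace ℝ (Fin n) × EuclideanSpace ℝ (Fin n) => b p.1 p.2 * χ p.2))
    (hχ : χ.HasTemperateGrowth) {v : 𝓢'(EuclideanSpace ℝ (Fin n), ℂ)}
    (hv : ∀ᶠ ξ in 𝓝ˢ (Distribution.dsupport (fourierD n v)), χ ξ = 1) : pdo hB v = T v := by
  have hext : IsExtension (fun x ξ => b x ξ * χ ξ) (T.comp (cutoffD χ)) := by
    intro u
    rw [ContinuousLinearMap.comp_apply, cutoffD_coe hχ, opS_mul_eq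
      (w := fourierSInv n (SchwartzMap.smulLeftCLM ℂ χ (fourierS n u))) fun ξ => by
        rw [fourierS_fourierSInv, SchwartzMap.smulLeftCLM_apply_apply hχ, smul_eq_mul]]
    exact hT _
  rw [(isExtension_pdo (b := fun x ξ => b x ξ * χ ξ) hB).unique hext,
    ContinuousLinearMap.comp_apply, cutoffD_eq_self hχ hv]

end Rule

end SupportRule

/-! ### Symbols of type `1, 1` -/

namespace SupportRule

/-- The value `b(x, D)v` for a symbol of type `1, 1` and `v` with compactly supported Fourier
transform: existence, independence of the cut-off, agreement with the integral formula and with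
every continuous extension of `b(x, D)`, and the support rule. -/
theorem supportRule_of_isSymbol_one_one {n : ℕ} {d : ℝ}
    {b : EuclideanSpace ℝ (Fin n) → EuclideanSpace ℝ (Fin n) → ℂ} (hb : IsSymbol d 1 1 b)
    (v : 𝓢'(EuclideanSpace ℝ (Fin n), ℂ))
    (hv : IsCompact (Distribution.dsupport (fourierD n v))) :
    ∃ f : 𝓢'(EuclideanSpace ℝ (Fin n), ℂ),
      IsOpValue b v f ∧
      (∀ f' : 𝓢'(EuclideanSpace ℝ (Fin n), ℂ), IsOpValue b v f' → f' = f) ∧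
      (∀ u : 𝓢(EuclideanSpace ℝ (Fin n), ℂ),
        v = (u : 𝓢'(EuclideanSpace ℝ (Fin n), ℂ)) → IsRepresentedBy f (opS b u)) ∧
      (∀ T : 𝓢'(EuclideanSpace ℝ (Fin n), ℂ) →L[ℂ] 𝓢'(EuclideanSpace ℝ (Fin n), ℂ),
        IsExtension b T → f = T v) ∧
      Distribution.dsupport (fourierD n f) ⊆ sumSet b v := by
  obtain ⟨χ, hχ, hχc, hχ1⟩ := exists_contDiff_hasCompactSupport_one_nhdsSet hv
  have hB := hb.isAmplitude_mul zero_le_one zero_le_one hχ hχc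
  refine ⟨pdo hB v, ⟨χ, pdo hB, hχ, hχc, hχ1, isExtension_pdo hB, rfl⟩, ?_, ?_, ?_,
    dsupport_fourierD_pdo_subset hB v hv hχ1⟩
  -- Both operators pair `v̂` with oscillatory integrals, which agree where `χ = χ' = 1`.
  · rintro _ ⟨χ', T', hχ', hχc', hχ1', hT', rfl⟩
    have hB' := hb.isAmplitude_mul zero_le_one zero_le_one hχ' hχc'
    rw [hT'.unique (isExtension_pdo (b := fun x ξ => b x ξ * χ' ξ) hB')]
    ext φ
    rw [pdo_apply, pdo_apply]
    congr 1
    refine apply_eq_of_eventually_eq _ ?_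
    filter_upwards [hχ1, hχ1'] with ξ h1 h2
    simp [oscIntegral, h1, h2]
  · rintro u rfl
    rw [← opS_mul_eq (χ := χ) (u := u) fun ξ => ?_]
    · exact isExtension_pdo (b := fun x ξ => b x ξ * χ ξ) hB u
    · by_cases hξ : ξ ∈ Distribution.dsupport (fourierD n (u : 𝓢'(EuclideanSpace ℝ (Fin n), ℂ)))
      · rw [hχ1.self_of_nhdsSet ξ hξ, one_mul]
      · rw [fourierS_eq_zero_of_notMem_dsupport u hξ, mul_zero]
  · intro T hT
    exact hT.pdo_eq hB (hχc.hasTemperateGrowth hχ) hχ1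

end SupportRule

theorem mainTheorem3 (n : ℕ) :
    (∀ (d : ℝ) (b : EuclideanSpace ℝ (Fin n) → EuclideanSpace ℝ (Fin n) → ℂ),
      SupportRule.IsSymbol d 1 0 b →
      ∃ T : 𝓢'(EuclideanSpace ℝ (Fin n), ℂ) →L[ℂ] 𝓢'(EuclideanSpace ℝ (Fin n), ℂ),
        SupportRule.IsExtension b T ∧
        (∀ T' : 𝓢'(EuclideanSpace ℝ (Fin n), ℂ) →L[ℂ] 𝓢'(EuclideanSpace ℝ (Fin n), ℂ),
          SupportRule.IsExtension b T' → T' = T) ∧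
        ∀ v : 𝓢'(EuclideanSpace ℝ (Fin n), ℂ),
          IsCompact (Distribution.dsupport (SupportRule.fourierD n v)) →
          Distribution.dsupport (SupportRule.fourierD n (T v)) ⊆ SupportRule.sumSet b v) ∧
    (∀ (d : ℝ) (b : EuclideanSpace ℝ (Fin n) → EuclideanSpace ℝ (Fin n) → ℂ),
      SupportRule.IsSymbol d 1 1 b →
      ∀ v : 𝓢'(EuclideanSpace ℝ (Fin n), ℂ),
        IsCompact (Distribution.dsupport (SupportRule.fourierD n v)) →
        ∃ f : 𝓢'(EuclideanSpace ℝ (Fin n), ℂ),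
          SupportRule.IsOpValue b v f ∧
          (∀ f' : 𝓢'(EuclideanSpace ℝ (Fin n), ℂ), SupportRule.IsOpValue b v f' → f' = f) ∧
          (∀ u : 𝓢(EuclideanSpace ℝ (Fin n), ℂ),
            v = (u : 𝓢'(EuclideanSpace ℝ (Fin n), ℂ)) →
            SupportRule.IsRepresentedBy f (SupportRule.opS b u)) ∧
          (∀ T : 𝓢'(EuclideanSpace ℝ (Fin n), ℂ) →L[ℂ] 𝓢'(EuclideanSpace ℝ (Fin n), ℂ),
            SupportRule.IsExtension b T → f = T v) ∧
          Distribution.dsupport (SupportRule.fourierD n f) ⊆ SupportRule.sumSet b v) := by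
  refine ⟨fun d b hb => ?_, fun d b hb v hv =>
    SupportRule.supportRule_of_isSymbol_one_one hb v hv⟩
  have hext := SupportRule.isExtension_pdo (hb.isAmplitude zero_le_one)
  -- A symbol of type `1, 0` is also one of type `1, 1`, whose values agree with any extension.
  refine ⟨_, hext, fun T' hT' => hT'.unique hext, fun v hv => ?_⟩
  obtain ⟨f, -, -, -, hf, hsupp⟩ :=
    SupportRule.supportRule_of_isSymbol_one_one (hb.mono_right zero_le_one) v hv
  rwa [hf _ hext] at hsupp
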